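/- Let $\mathcal M$ be a finite tree (the pattern) with at least three nodes; its nodes of degree at least $2$ are called internal, its leaves external. An occurrence of $\mathcal M$ in a tree $T$ is a set of nodes of $T$ onto which $\mathcal M$ can be embedded as an induced subgraph so that the degree in $T$ of the image of each internal node equals its degree in $\mathcal M$ (external nodes may be mapped to nodes of any degree). The mean constant $\mu>0$ of $\mathcal M$ is defined by: the expected number of occurrences of $\mathcal M$ in a uniformly random labeled (unrooted) tree of size $n$ is asymptotically equivalent to $\mu n$ as $n\to\infty$. A planted tree is a rooted tree whose root is joined to one additional phantom node (the plant). The planted patterns of $\mathcal M$ are obtained by choosing an internal node adjacent to an external node as the root and that external node as the plant. Let $D$ be the set of out-degrees of the internal nodes in them (the numbers $\deg(w)-1$, $w$ internal) and let $h$ be their maximal height. Let $a_0,\dots,a_L$ be the finite unordered rooted trees of height at most $h$ whose inner nodes have out-degrees in $D$, with leaves of type $\circ$ at level $h$ and of type $\Box$ at levels less than $h$; $a_0$ is the single leaf $\Box$. They partition the planted trees: a planted tree belongs to $a_j$ if $a_j$ is obtained from it by replacing, on each path from the root, the first node at depth less than $h$ with out-degree not in $D$, together with all that is below it, by $\Box$,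 and each node that then remains at depth $h$, together with all that is below it, by $\circ$. For $1\le j\le L$ let $\Lambda_j$ be the finite set of tuples $(l_0,\dots,l_L)$ of non-negative integers such that the planted trees whose root has exactly $l_i$ subtrees in class $a_i$ ($0\le i\le L$), and no others, belong to $a_j$, and let $K(l_0,\dots,l_L)$ be the number of occurrences of $\mathcal M$ in such a tree (the phantom node included) in which the root occurs as an internal node of $\mathcal M$; this number depends only on $(l_0,\dots,l_L)$. Put $$P_j(y_0,\dots,y_L,u)=\sum_{(l_0,\dots,l_L)\in\Lambda_j}\frac{1}{l_0!\cdots l_L!}\,y_0^{l_0}\cdots y_L^{l_L}\,u^{K(l_0,\dots,l_L)}\qquad(1\le j\le L),$$ and let $\mathbf F(x,\mathbf a,u)=(F_0,\dots,F_L)$ with $F_0=x e^{a_0+\cdots+a_L}-x\sum_{j=1}^L P_j(\mathbf a,1)$ and $F_j=x\,P_j(\mathbf a,u)$ for $1\le j\le L$. Let $\mathbf F_{\mathbf a}$ denote the Jacobian matrix of $\mathbf F$ with respect to $\mathbf a$. Then the system $\mathbf a=\mathbf F(x,\mathbf a,1)$, $\det(\mathbf I-\mathbf F_{\mathbf a}(x,\mathbf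 a,1))=0$ has a unique non-negative solution $(x_0,\mathbf a_0)$, and $x_0=1/e$. The matrix $\mathbf F_{\mathbf a}(1/e,\mathbf a_0,1)$ is non-negative, and $\mathbf b^{\mathrm T}=(1,\dots,1)$ is the left Perron eigenvector of $\mathbf I-\mathbf F_{\mathbf a}$ at $(1/e,\mathbf a_0,1)$, that is, $\mathbf b^{\mathrm T}(\mathbf I-\mathbf F_{\mathbf a})=\mathbf 0$, and every left null vector of $\mathbf I-\mathbf F_{\mathbf a}$ is a multiple of $\mathbf b^{\mathrm T}$. The mean constant $\mu$ of $\mathcal M$ exists and is given by $$\mu=\frac1e\sum_{j=1}^{L}\frac{\partial P_j}{\partial u}(\mathbf a_0,1),$$ and $\mu$ is a polynomial in $1/e$ with rational coefficients. -/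

import Mathlib

namespace TreePattern

/-! ### Occurrences of a pattern -/

section Occurrences

variable {W V : Type*} [Fintype W] [Fintype V]

/-- A node of the pattern is internal ("filled") if it is not a leaf; the leaves are the
external ("empty") nodes. -/
def IsInternal (M : SimpleGraph W) (w : W) : Prop :=
  2 ≤ (M.neighborSet w).ncard

open Classical in
/-- `f` embeds the pattern `M` in `G` as an induced subgraph, in such a way that the degree in `G`
of the image of each internal node is the degree of this node in `M` (the external nodes may be
mapped to nodes of arbitrary degree). -/
def IsMatch (M : SimpleGraph W) (G : SimpleGraph V) (f : M ↪g G) : Prop :=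
  ∀ w, IsInternal M w → G.degree (f w) = M.degree w

/-- The number of occurrences of `M` in `G`: the number of node sets of `G` onto which `M` matches.
Occurrences may overlap. -/
noncomputable def occ (M : SimpleGraph W) (G : SimpleGraph V) : ℕ :=
  {S : Set V | ∃ f : M ↪g G, IsMatch M G f ∧ Set.range f = S}.ncard

/-- The number of occurrences of `M` in `G` in which the node `r` of `G` occurs as an internal node
of the pattern. -/
noncomputable def occAt (M : SimpleGraph W) (G : SimpleGraph V) (r : V) : ℕ :=
  {S : Set V | ∃ f : M ↪g G, IsMatch M G f ∧ Set.range f = S ∧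
    ∃ w, IsInternal M w ∧ f w = r}.ncard

open Classical in
/-- The set of labeled (unrooted) trees of size `n`. -/
noncomputable def labeledTrees (n : ℕ) : Finset (SimpleGraph (Fin n)) :=
  Finset.univ.filter fun T => T.IsTree

/-- The expected number of occurrences of `M` in a uniformly random labeled tree of size `n`. -/
noncomputable def meanOcc (M : SimpleGraph W) (n : ℕ) : ℝ :=
  (∑ T ∈ labeledTrees n, (occ M T : ℝ)) / ((labeledTrees n).card : ℝ)

/-- `μ > 0` is the mean constant of the pattern `M`: the expected number of occurrences of `M` in a
random labeled tree of size `n` is asymptotically equivalent to `μ n`. -/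
def IsMeanConstant (M : SimpleGraph W) (μ : ℝ) : Prop :=
  0 < μ ∧ Asymptotics.IsEquivalent Filter.atTop
    (fun n : ℕ => meanOcc M n) (fun n : ℕ => μ * (n : ℝ))

end Occurrences

/-! ### Classes of planted trees -/

/-- The finite trees of height at most `k`, with unordered branches, all of whose out-degrees at
inner nodes lie in `D`, and with two types of leaves: leaves at level `k` (type `∘`), and leaves at
a level less than `k` (type `□`). A tree of height `0` is a single `∘`; a tree of height at most
`k + 1` is either `□` (that is, `none`), or a root with a multiset of `d ∈ D` branches of height
at most `k`. -/
def TreeClass (D : Finset ℕ) : ℕ → Type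
  | 0 => Unit
  | k + 1 => Option (Σ d : D, Sym (TreeClass D k) d)

/-- The classes of height at most `k + 1` other than `□`, given by the branches at the root. -/
abbrev Branching (D : Finset ℕ) (k : ℕ) : Type :=
  Σ d : D, Sym (TreeClass D k) d

noncomputable instance (D : Finset ℕ) (k : ℕ) : DecidableEq (TreeClass D k) :=
  Classical.decEq _

noncomputable instance instFintypeTreeClass (D : Finset ℕ) : (k : ℕ) → Fintype (TreeClass D k)
  | 0 => inferInstanceAs (Fintype Unit)
  | k + 1 =>
    letI := instFintypeTreeClass D k
    inferInstanceAs (Fintype (Option (Σ d : D, Sym (TreeClass D k) d)))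

/-- Cutting off the last level: whatever hangs at level `k` is replaced by `∘`. -/
def trunc (D : Finset ℕ) : (k : ℕ) → TreeClass D (k + 1) → TreeClass D k
  | 0, _ => ()
  | k + 1, c => Option.map (fun b : Branching D (k + 1) => ⟨b.1, b.2.map (trunc D k)⟩) c

open Classical in
/-- The nodes below `v` when `v` is entered from its parent `p`. -/
noncomputable def children {V : Type*} [Fintype V] (G : SimpleGraph V) (p v : V) : Finset V :=
  (G.neighborFinset v).erase p

open Classical in
/-- The class, of height at most `k`, of the tree below `v` when `v` is entered from its parent
`p`: along each path from `v`, the first node with out-degree not in `D` becomes a leaf `□`, and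
each node that remains at depth `k` becomes a leaf `∘`. -/
noncomputable def classOf (D : Finset ℕ) {V : Type*} [Fintype V] (G : SimpleGraph V) :
    (k : ℕ) → V → V → TreeClass D k
  | 0, _, _ => ()
  | k + 1, p, v =>
    if h : (children G p v).card ∈ D then
      some ⟨⟨(children G p v).card, h⟩,
        ⟨(children G p v).val.map (classOf D G k v), by simp⟩⟩
    else none

/-- `G` is a planted tree with phantom node `p` and root `r`. -/
def IsPlantedTree {V : Type*} (G : SimpleGraph V) (p r : V) : Prop :=
  G.IsTree ∧ G.neighborSet p = {r}

/-! ### The system of functional equations of a pattern -/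

section System

variable {W : Type*} [Fintype W] (M : SimpleGraph W)

open Classical in
/-- The set `D` of out-degrees of the internal nodes in the planted patterns of `M`. A planted
pattern arises from `M` by choosing an internal node as the root and an external node adjacent to it
as the plant; so each internal node has out-degree one less than its degree. -/
noncomputable def outDegrees : Finset ℕ :=
  (Finset.univ.filter fun w => IsInternal M w).image fun w => M.degree w - 1

open Classical in
/-- The maximal height of the planted patterns of `M` (with root `e.1` and plant `e.2`). -/
noncomputable def maxHeight : ℕ :=
  (Finset.univ.filter fun e : W × W =>
    IsInternal M e.1 ∧ ¬ IsInternal M e.2 ∧ M.Adj e.1 e.2).sup fun e =>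
      (Finset.univ.erase e.2).sup fun w => M.dist e.1 w

/-- `maxHeight M - 1`; a pattern with at least three nodes has `1 ≤ maxHeight M`. -/
noncomputable def subHeight : ℕ := maxHeight M - 1

/-- The index set of the classes `a_0, …, a_L` that partition the planted trees: the finite trees of
height at most `maxHeight M` with out-degrees in `D`. The class `a_0` is `none`. -/
abbrev Cls : Type := TreeClass (outDegrees M) (subHeight M + 1)

/-- The index set of the classes `a_1, …, a_L`. -/
abbrev PosCls : Type := Branching (outDegrees M) (subHeight M)

/-- The number `K(l_0, …, l_L)` of additional occurrences of `M` in `x a_0 ^ l_0 ⋯ a_L ^ l_L`,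
where `m` is the multiset containing `a_i` with multiplicity `l_i`: the number of occurrences of
`M` in which the root occurs as an internal node of the pattern, in any planted tree (the phantom
node included) whose subtrees at the root have the classes `m`. This number is the same
for all these trees. -/
noncomputable def addOcc (m : Multiset (Cls M)) : ℕ :=
  sInf {K | ∃ (V : Type) (_ : Fintype V) (G : SimpleGraph V) (p r : V),
    IsPlantedTree G p r ∧
    (children G p r).val.map (classOf (outDegrees M) G (subHeight M + 1) r) = m ∧
    occAt M G r = K}

/-- The set `Λ_j`: all terms `x a_0 ^ l_0 ⋯ a_L ^ l_L`, written as multisets of classes, in the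
recursive description of `a_j`. These are the possible ways of extending the branches
of `a_j` by one level. -/
noncomputable def terms (j : PosCls M) : Finset (Sym (Cls M) j.1) :=
  Finset.univ.filter fun m => m.map (trunc (outDegrees M) (subHeight M)) = j.2

/-- The polynomial `P_j(y_0, …, y_L, u)`, `1 ≤ j ≤ L`, that is, the sum over `Λ_j` of
`(l_0! ⋯ l_L!)⁻¹ y_0 ^ l_0 ⋯ y_L ^ l_L u ^ K(l_0, …, l_L)`. The variable `y_i` is
`X (Sum.inl i)`, and `u` is `X (Sum.inr ())`. -/
noncomputable def poly (j : PosCls M) : MvPolynomial (Cls M ⊕ Unit) ℚ :=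
  ∑ m ∈ terms M j,
    MvPolynomial.C (∏ i : Cls M, ((Multiset.count i (m : Multiset (Cls M))).factorial : ℚ))⁻¹ *
      (∏ i : Cls M, MvPolynomial.X (Sum.inl i) ^ Multiset.count i (m : Multiset (Cls M))) *
      MvPolynomial.X (Sum.inr ()) ^ addOcc M (m : Multiset (Cls M))

/-- The value at `(y, u)` of a polynomial in the variables `y_0, …, y_L, u`. -/
noncomputable def evalAt (y : Cls M → ℝ) (u : ℝ) (Q : MvPolynomial (Cls M ⊕ Unit) ℚ) : ℝ :=
  MvPolynomial.aeval (Sum.elim y fun _ => u) Q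

/-- The partial derivative `∂P_j/∂u`. -/
noncomputable def polyU (j : PosCls M) : MvPolynomial (Cls M ⊕ Unit) ℚ :=
  MvPolynomial.pderiv (Sum.inr ()) (poly M j)

/-- The right-hand side `F(x, a, u)` of the system of functional equations. -/
noncomputable def sysF (x : ℝ) (a : Cls M → ℝ) (u : ℝ) : Cls M → ℝ
  | none => x * Real.exp (∑ i, a i) - x * ∑ j, evalAt M a 1 (poly M j)
  | some j => x * evalAt M a u (poly M j)

/-- The Jacobian matrix `F_a(x, a, u)`: its entries are the partial derivatives of the components of
`F` with respect to the components of `a`. -/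
noncomputable def jacF (x : ℝ) (a : Cls M → ℝ) (u : ℝ) : Matrix (Cls M) (Cls M) ℝ :=
  Matrix.of fun i j => deriv (fun t => sysF M x (Function.update a j t) u i) (a j)

/-- `(x, a)` is a non-negative solution of `a = F(x, a, 1)`, `0 = det (I - F_a(x, a, 1))`. -/
def IsNonnegSolution (x : ℝ) (a : Cls M → ℝ) : Prop :=
  0 ≤ x ∧ (∀ i, 0 ≤ a i) ∧ a = sysF M x a 1 ∧ (1 - jacF M x a 1).det = 0

end System

/-- For the non-negative matrix `A`, the positive vector `b` is a left eigenvector of `A` with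
eigenvalue `1`, that is, `bᵀ (I - A) = 0`, and it is unique up to scaling. -/
structure IsLeftPerronVector {ι : Type*} [Fintype ι] [DecidableEq ι]
    (A : Matrix ι ι ℝ) (b : ι → ℝ) : Prop where
  nonneg : ∀ i j, 0 ≤ A i j
  pos : ∀ i, 0 < b i
  eigen : Matrix.vecMul b (1 - A) = 0
  unique : ∀ c : ι → ℝ, Matrix.vecMul c (1 - A) = 0 → ∃ t : ℝ, c = t • b

end TreePattern

/-! Both the system and the mean can be computed exactly, without singularity analysis.

At `u = 1` the right-hand side depends on the class weights only through the total weights of their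
truncations. At height `k + 1` it is `extend` after the linear map `push`, and by the multinomial
theorem `push` after `extend` is the same system at height `k` (`push_extend`). Hence solutions at
the two heights correspond, and the two Jacobians have the forms `E * P` and `P * E`, with the same
`det (1 - ·)` and corresponding left fixed vectors. At height 0 there remain `t = x e^t` and `1 = x
e^t`, so `t = 1` and `x = 1/e`. Climbing back up gives the solution `critWeight` and the vector of
ones (`eq_critWeight`, `vecMul_one_jac`).

Let `M` have `w` nodes, `ℓ` of them external and `i` internal. Both sides of the formula for `μ`
turn out to be `(ℓ / |Aut M|) e^(-i)`. Between trees, a map that is bijective on the neighbors of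
every internal node (`LocalIso`) is already an embedding, and such maps number `|Aut M|` times the
occurrences.

On the side of the system, an occurrence with internal root maps some external node `q` to the
phantom node. For fixed `q` the weighted number of maps factors over the internal nodes: out-degree
`d` has weight `e⁻¹ / d!`, and there are `d!` bijections between the children, so each internal node
contributes `1/e` (`sum_critWeight_mul_branchCount`, `sum_evalAt_polyU_critWeight`).

On the side of the mean, the labeled trees in which a given injection is an occurrence are the
forests on the other `n - w` nodes rooted at the `ℓ` external ones. There are `ℓ (n - i)^(n - w -
1)` of them (`numForests_eq`, `card_trees_localIso_eq`). Summing over the injections and dividing by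
Cayley's `n^(n - 2)` gives a mean asymptotic to `μ n` (`isMeanConstant`). -/

namespace TreePattern

open Finset

set_option linter.unusedSectionVars false
set_option linter.unusedDecidableInType false

/-! ### Multisets, symmetry factors and multinomial sums -/

section Multisets

variable {X Y α : Type*} [Fintype X] [Fintype Y] [Fintype α] [DecidableEq α]
  [DecidableEq X] [DecidableEq Y]

/-- The product of the factorials of the multiplicities of a multiset. -/
def symmFactor (s : Multiset α) : ℕ := ∏ i, (s.count i).factorial

lemma symmFactor_pos (s : Multiset α) : 0 < symmFactor s :=
  Finset.prod_pos fun _ _ => Nat.factorial_pos _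

lemma count_map_univ (h : X → α) (i : α) :
    ((univ : Finset X).val.map h).count i = Fintype.card {x // h x = i} := by
  rw [Multiset.count_map, Fintype.card_subtype, ← Finset.filter_val, Finset.card_val]
  simp only [eq_comm]

lemma exists_equiv_comp_eq (φ : Y → α) (h : X → α)
    (hm : (univ : Finset X).val.map h = (univ : Finset Y).val.map φ) :
    ∃ β : X ≃ Y, φ ∘ β = h := by
  have hc : ∀ i, Nonempty ({x // h x = i} ≃ {y // φ y = i}) := fun i => by
    rw [← Fintype.card_eq, ← count_map_univ, ← count_map_univ, hm]
  exact ⟨Equiv.ofFiberEquiv fun i => Classical.choice (hc i),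
    funext fun x => Equiv.ofFiberEquiv_map _ x⟩

/-- Once one such bijection exists, all of them arise from it by composing with the stabilizer of
`φ` in the permutations of `Y`, whose order is the product of the factorials of the fiber sizes. -/
lemma card_equiv_comp_eq (φ : Y → α) (h : X → α)
    (hm : (univ : Finset X).val.map h = (univ : Finset Y).val.map φ) :
    #{β : X ≃ Y | φ ∘ β = h} = symmFactor ((univ : Finset Y).val.map φ) := by
  obtain ⟨β₀, hβ₀⟩ := exists_equiv_comp_eq φ h hm
  simp only [symmFactor, count_map_univ]
  rw [← DomMulAct.stabilizer_card, ← Fintype.card_subtype]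
  refine Fintype.card_congr
    { toFun := fun β => ⟨β₀.symm.trans β.1, ?_⟩
      invFun := fun σ => ⟨β₀.trans σ.1, ?_⟩
      left_inv := fun β => by ext; simp
      right_inv := fun σ => by ext; simp }
  · funext y
    have h1 := congrFun β.2 (β₀.symm y)
    have h2 := congrFun hβ₀ (β₀.symm y)
    simp only [Function.comp_apply, Equiv.apply_symm_apply, Equiv.trans_apply] at *
    rw [h1, h2]
  · funext x
    have h1 := congrFun σ.2 (β₀ x)
    have h2 := congrFun hβ₀ x
    simp only [Function.comp_apply, Equiv.trans_apply] at *
    rw [h1, h2]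

/-- A sum over the bijections between two finite types, of a function of the labels. -/
lemma sum_equiv_comp {R : Type*} [CommSemiring R] (φ : Y → α)
    (Φ : (X → α) → R) :
    ∑ β : X ≃ Y, Φ (φ ∘ β) = symmFactor ((univ : Finset Y).val.map φ) *
      ∑ h : X → α with (univ : Finset X).val.map h = (univ : Finset Y).val.map φ, Φ h := by
  have hmap : ∀ β : X ≃ Y, (univ : Finset X).val.map (φ ∘ β) = (univ : Finset Y).val.map φ := by
    intro β
    rw [← Multiset.map_map]
    congr 1
    exact congrArg Finset.val (Finset.map_univ_equiv β)
  rw [← Finset.sum_fiberwise_of_maps_to (s := univ) (t := univ.filter fun h : X → α =>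
    (univ : Finset X).val.map h = (univ : Finset Y).val.map φ) (g := fun β : X ≃ Y => φ ∘ β)
    (fun β _ => by simpa using hmap β), Finset.mul_sum]
  refine Finset.sum_congr rfl fun h hh => ?_
  rw [Finset.sum_congr rfl (g := fun _ => Φ h), Finset.sum_const,
    card_equiv_comp_eq φ h (by simpa using hh), nsmul_eq_mul]
  intro β hβ
  rw [(Finset.mem_filter.mp hβ).2]

/-- Orbit and stabilizer for the permutations of `X` acting on the labelings of `X` with label
multiset `s`. -/
lemma card_functions_mul_symmFactor (s : Multiset α) (hs : s.card = Fintype.card X) :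
    #{h : X → α | (univ : Finset X).val.map h = s} * symmFactor s = (Fintype.card X).factorial := by
  classical
  obtain ⟨φ, rfl⟩ : ∃ φ : X → α, (univ : Finset X).val.map φ = s := by
    obtain ⟨l, rfl⟩ := Quot.exists_rep s
    have hl : l.length = Fintype.card X := hs
    let e : X ≃ Fin l.length := Fintype.equivFinOfCardEq hl.symm
    refine ⟨fun x => l.get (e x), ?_⟩
    have : (fun x => l.get (e x)) = l.get ∘ e := rfl
    rw [this, ← Multiset.map_map]
    have h2 : Multiset.map e (univ : Finset X).val = (univ : Finset (Fin l.length)).val :=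
      congrArg Finset.val (Finset.map_univ_equiv e)
    rw [h2]
    exact Fin.univ_val_map l.get |>.trans (by simp)
  have := sum_equiv_comp (X := X) φ (fun _ => (1 : ℕ))
  simp only [Finset.sum_const, smul_eq_mul, mul_one, Finset.card_univ] at this
  rw [Fintype.card_perm] at this
  rw [this, mul_comm]
  simp

/-- A sum over multisets, weighted by symmetry factors, as a sum over functions. -/
lemma sum_sym_eq_sum_functions {R : Type*} [Field R] [CharZero R] {d : ℕ}
    (hd : Fintype.card X = d) (F : Multiset α → R) :
    ∑ s : Sym α d, F s / (symmFactor (s : Multiset α)) =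
      (∑ h : X → α, F ((univ : Finset X).val.map h)) / d.factorial := by
  let T : (X → α) → Sym α d := fun h => ⟨(univ : Finset X).val.map h, by simp [hd]⟩
  rw [← Finset.sum_fiberwise (s := (univ : Finset (X → α))) (g := T), Finset.sum_div]
  refine Finset.sum_congr rfl fun s _ => ?_
  have h1 : ∀ h : X → α, T h = s ↔ (univ : Finset X).val.map h = (s : Multiset α) :=
    fun h => Subtype.ext_iff
  simp only [h1]
  have hcard := card_functions_mul_symmFactor (X := X) (s : Multiset α) (s.2.trans hd.symm)
  rw [Finset.sum_congr rfl (g := fun _ => F s)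
    (fun h hh => by rw [(Finset.mem_filter.mp hh).2]), Finset.sum_const, nsmul_eq_mul,
    show d.factorial = _ from hd ▸ hcard.symm]
  have hpos : (symmFactor (s : Multiset α) : R) ≠ 0 := by
    exact_mod_cast (symmFactor_pos _).ne'
  have hpos2 : ((#{h : X → α | (univ : Finset X).val.map h = (s : Multiset α)} : ℕ) : R) ≠ 0 := by
    intro h0
    rw [Nat.cast_eq_zero] at h0
    rw [h0, zero_mul] at hcard
    exact (Nat.factorial_pos _).ne hcard
  push_cast
  field_simp

/-- The weight `∏ y_i ^ l_i / l_i!` of a multiset with multiplicities `l_i`. -/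
noncomputable def wt (y : α → ℝ) (s : Multiset α) : ℝ :=
  ∏ i, y i ^ s.count i / (s.count i).factorial

lemma wt_eq (y : α → ℝ) (s : Multiset α) : wt y s = (s.map y).prod / symmFactor s := by
  rw [wt, symmFactor, Finset.prod_div_distrib, Nat.cast_prod]
  congr 1
  rw [Finset.prod_multiset_map_count]
  refine (Finset.prod_subset (Finset.subset_univ _) fun i _ hi => ?_).symm
  rw [Multiset.count_eq_zero.mpr (by simpa using hi), pow_zero]

lemma wt_pos {y : α → ℝ} (hy : ∀ i, 0 < y i) (s : Multiset α) : 0 < wt y s :=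
  Finset.prod_pos fun i _ => div_pos (pow_pos (hy i) _) (by positivity)

lemma sum_wt_mul (X : Type*) [Fintype X] [DecidableEq X] {d : ℕ} (hd : Fintype.card X = d)
    (y : α → ℝ) (F : Multiset α → ℝ) :
    ∑ s : Sym α d, wt y s * F s =
      (∑ h : X → α, (∏ x, y (h x)) * F ((univ : Finset X).val.map h)) / d.factorial := by
  have := sum_sym_eq_sum_functions (X := X) hd fun s : Multiset α => (s.map y).prod * F s
  simp only [Multiset.map_map] at this
  rw [← Finset.sum_congr rfl fun (s : Sym α d) _ => ?_]
  · exact this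
  · rw [wt_eq]; ring

lemma sum_wt (d : ℕ) (y : α → ℝ) :
    ∑ s : Sym α d, wt y s = (∑ i, y i) ^ d / d.factorial := by
  have := sum_wt_mul (Fin d) (Fintype.card_fin d) y fun _ => 1
  simp only [mul_one] at this
  rw [this, Fintype.sum_pow]

/-- The weights of the multisets with a given image add up to the weight of the image. -/
lemma sum_wt_map_eq {β : Type*} [Fintype β] [DecidableEq β] {d : ℕ} (y : α → ℝ) (τ : α → β)
    (t : Sym β d) :
    ∑ s : Sym α d with s.map τ = t, wt y s = wt (fun b => ∑ i with τ i = b, y i) t := by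
  have hmap : ∀ (s : Sym α d), s.map τ = t ↔ (s : Multiset α).map τ = t := fun s => by
    rw [← Sym.coe_inj]; rfl
  simp only [hmap]
  have h1 := sum_wt_mul (Fin d) (Fintype.card_fin d) y fun s => if s.map τ = (t : Multiset β) then 1 else 0
  have h2 := sum_wt_mul (Fin d) (Fintype.card_fin d) (fun b => ∑ i with τ i = b, y i)
    fun s => if s = (t : Multiset β) then 1 else 0
  simp only [mul_ite, mul_one, mul_zero] at h1 h2
  rw [Finset.sum_filter, h1]
  have h3 : ∀ s : Sym β d, ((s : Multiset β) = t) ↔ s = t := fun s => Sym.coe_inj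
  simp only [h3, Finset.sum_ite_eq', Finset.mem_univ, if_true] at h2
  rw [h2]
  congr 1
  -- For a fixed image `g = τ ∘ h` the values of `h` vary independently in the fibers of `τ`, so the
  -- sum over `h` factors into fiber sums.
  rw [← Finset.sum_fiberwise (s := univ) (g := fun h : Fin d → α => τ ∘ h)]
  refine Finset.sum_congr rfl fun g _ => ?_
  have h4 : ∀ h : Fin d → α, h ∈ univ.filter (fun h : Fin d → α => τ ∘ h = g) →
      (if Multiset.map τ (Multiset.map h (univ : Finset (Fin d)).val) = (t : Multiset β)
        then ∏ x, y (h x) else 0) =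
      if Multiset.map g (univ : Finset (Fin d)).val = (t : Multiset β)
        then ∏ x, y (h x) else 0 := by
    intro h hh
    rw [Multiset.map_map, (Finset.mem_filter.mp hh).2]
  rw [Finset.sum_congr rfl h4]
  split_ifs
  · rw [Finset.prod_univ_sum]
    refine Finset.sum_congr ?_ fun _ _ => rfl
    ext h
    simp [Fintype.mem_piFinset, funext_iff]
  · simp

end Multisets

/-! ### Reduction of the system from height k + 1 to height k -/

section Levels

variable (D : Finset ℕ) (x : ℝ)

lemma sum_treeClass_succ {R : Type*} [AddCommMonoid R] {k : ℕ} (f : TreeClass D (k + 1) → R) :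
    ∑ c, f c = f none + ∑ j : Branching D k, f (some j) :=
  Fintype.sum_option (α := Branching D k) f

noncomputable instance uniqueTreeClassZero : Unique (TreeClass D 0) :=
  inferInstanceAs (Unique Unit)

/-- The total weight of all the classes with a given truncation. -/
noncomputable def push (k : ℕ) (a : TreeClass D (k + 1) → ℝ) : TreeClass D k → ℝ :=
  fun c => ∑ i with trunc D k i = c, a i

/-- The right-hand side of the system at height `k + 1`, as a function of the weights of the classes
of height at most `k`. -/
noncomputable def extend (k : ℕ) (b : TreeClass D k → ℝ) : TreeClass D (k + 1) → ℝ
  | none => x * Real.exp (∑ i, b i) - x * ∑ d ∈ D, (∑ i, b i) ^ d / (d.factorial : ℝ)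
  | some j => x * wt b j.2

/-- The system of functional equations of the classes of height at most `k`. -/
noncomputable def levelSys : (k : ℕ) → (TreeClass D k → ℝ) → TreeClass D k → ℝ
  | 0, b => fun _ => x * Real.exp (∑ i, b i)
  | k + 1, a => extend D x k (push D k a)

lemma sum_push (k : ℕ) (a : TreeClass D (k + 1) → ℝ) : ∑ c, push D k a c = ∑ i, a i :=
  Finset.sum_fiberwise _ _ _

lemma sum_branching_wt (k : ℕ) (b : TreeClass D k → ℝ) :
    ∑ j : Branching D k, wt b j.2 = ∑ d ∈ D, (∑ i, b i) ^ d / (d.factorial : ℝ) := by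
  rw [Fintype.sum_sigma, ← Finset.sum_coe_sort D]
  exact Finset.sum_congr rfl fun d _ => sum_wt _ _

lemma sum_extend (k : ℕ) (b : TreeClass D k → ℝ) :
    ∑ i, extend D x k b i = x * Real.exp (∑ i, b i) := by
  rw [sum_treeClass_succ]
  simp only [extend]
  rw [← Finset.mul_sum, sum_branching_wt]
  ring

lemma sum_branching_wt_trunc (k : ℕ) (b : TreeClass D (k + 1) → ℝ) (j : Branching D k)
    (c : TreeClass D (k + 1)) (hc : c = some j) :
    ∑ i : Branching D (k + 1) with trunc D (k + 1) (some i) = c, wt b i.2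
      = wt (push D k b) j.2 := by
  subst hc
  obtain ⟨d, s⟩ := j
  rw [Finset.sum_filter, Fintype.sum_sigma, Finset.sum_eq_single d]
  · refine Eq.trans ?_ (sum_wt_map_eq b (trunc D k) s)
    rw [Finset.sum_filter]
    refine Finset.sum_congr rfl fun i _ => ?_
    by_cases h : i.map (trunc D k) = s
    · rw [if_pos h, if_pos]
      subst h
      rfl
    · rw [if_neg h, if_neg]
      exact fun h' => h (by simpa using Option.some.inj h')
  · intro d' _ hd'
    refine Finset.sum_eq_zero fun i _ => if_neg fun h => hd' ?_
    exact congrArg Sigma.fst (Option.some.inj h)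
  · simp

/-- The heart of the reduction: `levelSys` at height `k + 1` is `extend` after `push`, and in the
opposite order the two maps give `levelSys` at height `k`. Only `□` truncates to `□` at positive
height, and the other weights are regrouped by the multinomial theorem. -/
lemma push_extend (k : ℕ) (b : TreeClass D k → ℝ) :
    push D k (extend D x k b) = levelSys D x k b := by
  cases k with
  | zero =>
    funext c
    simp only [push, levelSys]
    rw [Finset.filter_true_of_mem fun i _ => Subsingleton.elim _ _, sum_extend]
  | succ k =>
    funext c
    simp only [push, levelSys]
    rw [Finset.sum_filter, sum_treeClass_succ]
    cases c with
    | none =>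
      have h1 : trunc D (k + 1) none = none := rfl
      rw [if_pos h1, Finset.sum_eq_zero, add_zero]
      · simp only [extend, sum_push]
      · intro j _
        rw [if_neg]
        exact fun h => Option.some_ne_none _ h
    | some j =>
      have h1 : ¬ trunc D (k + 1) none = some j := fun h => Option.some_ne_none _ h.symm
      rw [if_neg h1, zero_add, ← Finset.sum_filter]
      simp only [extend]
      rw [← Finset.mul_sum, sum_branching_wt_trunc D k b j _ rfl]

/-- The Jacobian matrix of a map between function spaces. -/
noncomputable def jac {ι κ : Type*} [DecidableEq ι] (Φ : (ι → ℝ) → κ → ℝ) (a : ι → ℝ) :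
    Matrix κ ι ℝ :=
  Matrix.of fun i j => deriv (fun t => Φ (Function.update a j t) i) (a j)

/-- The matrix of `push`. -/
noncomputable def pushMatrix (k : ℕ) : Matrix (TreeClass D k) (TreeClass D (k + 1)) ℝ :=
  Matrix.of fun c i => if trunc D k i = c then 1 else 0

/-- Moving one class weight moves only the weight of its truncation, and by the same amount; as a
curve this is a translated coordinate line. -/
lemma push_update (k : ℕ) (a : TreeClass D (k + 1) → ℝ) (j : TreeClass D (k + 1)) (t : ℝ) :
    push D k (Function.update a j t) = Function.update (push D k a) (trunc D k j)
      (t + (push D k a (trunc D k j) - a j)) := by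
  funext c
  by_cases hc : c = trunc D k j
  · subst hc
    simp only [Function.update_self]
    have hj : j ∈ univ.filter fun i => trunc D k i = trunc D k j := by simp
    simp only [push]
    rw [Finset.sum_update_of_mem hj, Finset.sum_eq_add_sum_sdiff_singleton_of_mem hj a]
    ring
  · rw [Function.update_of_ne hc]
    simp only [push]
    refine Finset.sum_congr rfl fun i hi => Function.update_of_ne ?_ _ _
    rintro rfl
    exact hc (Finset.mem_filter.mp hi).2.symm

/-- The chain rule for an inner `push`. Coordinate lines go to translated coordinate lines, so it
holds for arbitrary `Φ`, also where `deriv` has its default value. -/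
lemma jac_comp_push {κ : Type*} (k : ℕ) (Φ : (TreeClass D k → ℝ) → κ → ℝ)
    (a : TreeClass D (k + 1) → ℝ) :
    jac (fun a => Φ (push D k a)) a = jac Φ (push D k a) * pushMatrix D k := by
  ext i j
  rw [Matrix.mul_apply]
  simp only [jac, pushMatrix, Matrix.of_apply, mul_ite, mul_one, mul_zero, Finset.sum_ite_eq,
    Finset.mem_univ, if_true, push_update]
  rw [deriv_comp_add_const (f := fun t => Φ (Function.update (push D k a) (trunc D k j) t) i)]
  congr 1
  ring

lemma jac_push_comp {ι : Type*} [DecidableEq ι] (k : ℕ)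
    (Φ : (ι → ℝ) → TreeClass D (k + 1) → ℝ) (b : ι → ℝ)
    (hΦ : ∀ i j, DifferentiableAt ℝ (fun t => Φ (Function.update b j t) i) (b j)) :
    jac (fun b => push D k (Φ b)) b = pushMatrix D k * jac Φ b := by
  ext c j
  rw [Matrix.mul_apply]
  simp only [jac, pushMatrix, Matrix.of_apply, ite_mul, one_mul, zero_mul, push]
  rw [← Finset.sum_filter, deriv_fun_sum fun i _ => hΦ i j]

lemma differentiable_extend (k : ℕ) (i : TreeClass D (k + 1)) :
    Differentiable ℝ fun b => extend D x k b i := by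
  cases i with
  | none => simp only [extend]; fun_prop
  | some j =>
    simp only [extend, wt, div_eq_mul_inv]
    fun_prop

lemma differentiableAt_extend_update (k : ℕ) (b : TreeClass D k → ℝ) (i : TreeClass D (k + 1))
    (j : TreeClass D k) :
    DifferentiableAt ℝ (fun t => extend D x k (Function.update b j t) i) (b j) :=
  DifferentiableAt.comp (b j) (g := fun b => extend D x k b i) (differentiable_extend D x k i _)
    (hasDerivAt_update b j (b j)).differentiableAt

lemma jac_levelSys_succ (k : ℕ) (a : TreeClass D (k + 1) → ℝ) :
    jac (levelSys D x (k + 1)) a = jac (extend D x k) (push D k a) * pushMatrix D k :=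
  jac_comp_push D k (extend D x k) a

lemma jac_levelSys (k : ℕ) (b : TreeClass D k → ℝ) :
    jac (levelSys D x k) b = pushMatrix D k * jac (extend D x k) b := by
  rw [← jac_push_comp D k (extend D x k) b fun i j => differentiableAt_extend_update D x k b i j]
  simp only [push_extend]

/-- Sylvester's identity `det (1 - E * P) = det (1 - P * E)` for the rectangular factors of the
Jacobians. -/
lemma det_one_sub_jac_levelSys_succ (k : ℕ) (a : TreeClass D (k + 1) → ℝ) :
    (1 - jac (levelSys D x (k + 1)) a).det = (1 - jac (levelSys D x k) (push D k a)).det := by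
  rw [jac_levelSys_succ, jac_levelSys, Matrix.det_one_sub_mul_comm]

lemma push_eq_levelSys {k : ℕ} {a : TreeClass D (k + 1) → ℝ} (ha : a = levelSys D x (k + 1) a) :
    push D k a = levelSys D x k (push D k a) := by
  conv_lhs => rw [ha]
  exact push_extend D x k _

lemma jac_levelSys_zero (b : TreeClass D 0 → ℝ) (i j : TreeClass D 0) :
    jac (levelSys D x 0) b i j = levelSys D x 0 b i := by
  simp only [jac, levelSys, Matrix.of_apply, Fintype.sum_unique]
  obtain rfl : j = default := Subsingleton.elim _ _
  simp only [Function.update_self]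
  exact ((Real.hasDerivAt_exp (b default)).const_mul x).deriv

lemma det_one_sub_jac_levelSys_zero (b : TreeClass D 0 → ℝ) :
    (1 - jac (levelSys D x 0) b).det = 1 - levelSys D x 0 b default := by
  rw [Matrix.det_unique, Matrix.sub_apply, jac_levelSys_zero, Matrix.one_apply_eq]

/-- The weights of the classes at the singularity: the probabilities of the classes of a
Galton-Watson tree with Poisson offspring distribution of mean one. -/
noncomputable def critWeight : (k : ℕ) → TreeClass D k → ℝ
  | 0 => fun _ => 1
  | k + 1 => extend D (1 / Real.exp 1) k (critWeight k)

/-- At height 0 the determinant condition says `x e^t = 1`, which with `t = x e^t` leaves one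
solution. Higher up, `push D k a` solves the lower system and determines `a`, since `a` is its
`extend`. -/
lemma eq_critWeight (k : ℕ) (a : TreeClass D k → ℝ) (ha : a = levelSys D x k a)
    (hdet : (1 - jac (levelSys D x k) a).det = 0) :
    x = 1 / Real.exp 1 ∧ a = critWeight D k := by
  induction k with
  | zero =>
    rw [det_one_sub_jac_levelSys_zero, sub_eq_zero] at hdet
    have ha1 : a default = 1 := by rw [ha, ← hdet]
    refine ⟨?_, funext fun i => ?_⟩
    · simp only [levelSys, Fintype.sum_unique, ha1] at hdet
      rw [eq_div_iff (Real.exp_ne_zero _), ← hdet]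
    · rw [Subsingleton.elim i default, ha1]
      rfl
  | succ k ih =>
    rw [det_one_sub_jac_levelSys_succ] at hdet
    obtain ⟨h1, h2⟩ := ih _ (push_eq_levelSys D x ha) hdet
    refine ⟨h1, ?_⟩
    rw [ha]
    simp only [levelSys, critWeight, h2, h1]

lemma push_critWeight_and_eq (k : ℕ) :
    critWeight D k = levelSys D (1 / Real.exp 1) k (critWeight D k) ∧
      push D k (critWeight D (k + 1)) = critWeight D k := by
  have key : critWeight D k = levelSys D (1 / Real.exp 1) k (critWeight D k) := by
    induction k with
    | zero =>
      funext i
      simp [critWeight, levelSys]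
    | succ k ih =>
      simp only [levelSys]
      rw [show critWeight D (k + 1) = extend D (1 / Real.exp 1) k (critWeight D k) from rfl,
        push_extend, ← ih]
  refine ⟨key, ?_⟩
  rw [show critWeight D (k + 1) = extend D (1 / Real.exp 1) k (critWeight D k) from rfl,
    push_extend, ← key]

lemma sum_critWeight (k : ℕ) : ∑ i, critWeight D k i = 1 := by
  induction k with
  | zero => simp [critWeight]
  | succ k ih => rw [← sum_push, (push_critWeight_and_eq D k).2, ih]

lemma det_one_sub_jac_critWeight (k : ℕ) :
    (1 - jac (levelSys D (1 / Real.exp 1) k) (critWeight D k)).det = 0 := by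
  induction k with
  | zero =>
    rw [det_one_sub_jac_levelSys_zero, ← (push_critWeight_and_eq D 0).1]
    simp [critWeight]
  | succ k ih =>
    rw [det_one_sub_jac_levelSys_succ, (push_critWeight_and_eq D k).2, ih]

lemma sum_inv_factorial_le (f : ℕ → ℝ) (hf : ∀ n, f n = 1 / (n.factorial : ℝ)) :
    ∑ d ∈ D, f d ≤ Real.exp 1 := by
  have h := NormedSpace.expSeries_div_hasSum_exp (1 : ℝ)
  rw [← Real.exp_eq_exp_ℝ] at h
  refine sum_le_hasSum D (fun i _ => ?_) (h.congr_fun fun n => ?_)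
  all_goals simp [hf]

end Levels

/-! ### Positivity of the solution and the left Perron vector -/

section Perron

variable (D : Finset ℕ)

/-- A finite `D` misses some term of the exponential series. The strictness makes the weight of `□`
positive. -/
lemma sum_inv_factorial_lt : ∑ d ∈ D, 1 / (d.factorial : ℝ) < Real.exp 1 := by
  obtain ⟨n, hn⟩ := Infinite.exists_notMem_finset D
  have h := sum_inv_factorial_le (insert n D) _ fun _ => rfl
  rw [Finset.sum_insert hn] at h
  have : 0 < 1 / (n.factorial : ℝ) := by positivity
  linarith

lemma critWeight_pos (k : ℕ) (i : TreeClass D k) : 0 < critWeight D k i := by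
  induction k with
  | zero => exact one_pos
  | succ k ih =>
    cases i with
    | none =>
      simp only [critWeight, extend, sum_critWeight, one_pow]
      rw [← mul_sub]
      exact mul_pos (by positivity) (sub_pos.mpr (sum_inv_factorial_lt D))
    | some j =>
      exact mul_pos (by positivity) (wt_pos ih _)

/-- The weight of `□` depends on `b` only through its sum, so the derivative is the same for every
`j`. -/
lemma hasDerivAt_extend_none (x : ℝ) (k : ℕ) (b : TreeClass D k → ℝ) (j : TreeClass D k) :
    HasDerivAt (fun t => extend D x k (Function.update b j t) none)
      (x * Real.exp (∑ i, b i) -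
        x * ∑ d ∈ D, (d : ℝ) * (∑ i, b i) ^ (d - 1) / (d.factorial : ℝ)) (b j) := by
  have hsum : ∀ t, ∑ i, Function.update b j t i = t + (∑ i, b i - b j) := fun t => by
    rw [Finset.sum_update_of_mem (Finset.mem_univ j),
      Finset.sum_eq_add_sum_sdiff_singleton_of_mem (Finset.mem_univ j) b]
    ring
  simp only [extend, hsum]
  have h0 : HasDerivAt (fun t => t + (∑ i, b i - b j)) 1 (b j) := (hasDerivAt_id _).add_const _
  have hval : b j + (∑ i, b i - b j) = ∑ i, b i := by ring
  have h1 := (h0.exp).const_mul x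
  have h2 : HasDerivAt (fun t => ∑ d ∈ D, (t + (∑ i, b i - b j)) ^ d / (d.factorial : ℝ))
      (∑ d ∈ D, (d : ℝ) * (∑ i, b i) ^ (d - 1) / (d.factorial : ℝ)) (b j) := by
    refine HasDerivAt.fun_sum fun d _ => ?_
    have := (h0.fun_pow d).div_const (d.factorial : ℝ)
    simpa only [hval, mul_one] using this
  have h3 := h1.fun_sub (h2.const_mul x)
  simpa only [hval, mul_one] using h3

lemma jac_extend_nonneg (k : ℕ) (i : TreeClass D (k + 1)) (j : TreeClass D k) :
    0 ≤ jac (extend D (1 / Real.exp 1) k) (critWeight D k) i j := by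
  simp only [jac, Matrix.of_apply]
  cases i with
  | none =>
    rw [(hasDerivAt_extend_none D _ k _ j).deriv]
    simp only [sum_critWeight, one_pow, mul_one]
    rw [← mul_sub]
    refine mul_nonneg (by positivity) (sub_nonneg.mpr ?_)
    -- `d / d!` is `1 / (d - 1)!` except at `d = 0`, where it vanishes while truncated subtraction
    -- would give 1. On nonzero `d` the shift is injective, so what remains is again bounded by the
    -- series of `e`.
    have h0 : ∀ d ∈ D, (d : ℝ) / (d.factorial : ℝ) ≤
        if d = 0 then 0 else 1 / ((d - 1).factorial : ℝ) := by
      intro d _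
      cases d with
      | zero => simp
      | succ d =>
        rw [if_neg d.succ_ne_zero, Nat.factorial_succ, Nat.add_sub_cancel]
        push_cast
        rw [div_le_div_iff₀ (by positivity) (by positivity)]
        linarith
    refine (Finset.sum_le_sum h0).trans ?_
    have h4 : ∑ d ∈ D, (if d = 0 then 0 else 1 / ((d - 1).factorial : ℝ)) =
        ∑ d ∈ D with ¬ d = 0, 1 / ((d - 1).factorial : ℝ) := by
      rw [Finset.sum_filter]
      exact Finset.sum_congr rfl fun d _ => by split_ifs <;> simp_all
    rw [h4]
    have hinj : Set.InjOn (fun d => d - 1) (D.filter fun d => ¬ d = 0 : Finset ℕ) := by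
      intro d hd e he h
      have hd := (Finset.mem_filter.mp hd).2
      have he := (Finset.mem_filter.mp he).2
      simp only at h
      omega
    have := Finset.sum_image (f := fun n => 1 / (n.factorial : ℝ)) hinj
    rw [← this]
    exact sum_inv_factorial_le _ _ fun _ => rfl
  | some s =>
    have h : ∀ t, extend D (1 / Real.exp 1) k (Function.update (critWeight D k) j t) (some s) =
        (1 / Real.exp 1) * (∏ i ∈ univ \ {j}, critWeight D k i ^ (s.2 : Multiset _).count i /
          ((s.2 : Multiset _).count i).factorial) / ((s.2 : Multiset _).count j).factorial *
        t ^ (s.2 : Multiset _).count j := by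
      intro t
      simp only [extend, wt]
      rw [Finset.prod_eq_mul_prod_sdiff_singleton_of_mem (Finset.mem_univ j), Function.update_self,
        Finset.prod_congr rfl fun i hi => by
          rw [Function.update_of_ne (by simpa using hi)]]
      ring
    simp only [h]
    rw [deriv_const_mul_field, deriv_pow_field]
    have hpos := critWeight_pos D k
    have : 0 ≤ ∏ i ∈ univ \ {j}, critWeight D k i ^ (s.2 : Multiset _).count i /
          (((s.2 : Multiset _).count i).factorial : ℝ) :=
      Finset.prod_nonneg fun i _ => by have := hpos i; positivity
    have := hpos j
    positivity

lemma jac_levelSys_nonneg (k : ℕ) (i j : TreeClass D (k + 1)) :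
    0 ≤ jac (levelSys D (1 / Real.exp 1) (k + 1)) (critWeight D (k + 1)) i j := by
  rw [jac_levelSys_succ, (push_critWeight_and_eq D k).2, Matrix.mul_apply]
  refine Finset.sum_nonneg fun c _ => mul_nonneg (jac_extend_nonneg D k i c) ?_
  simp only [pushMatrix, Matrix.of_apply]
  split_ifs <;> norm_num

open Matrix in
-- Every class has exactly one truncation, so the columns of `P` sum to 1, that is, `1 P = 1`. If `c
-- = c E P`, then `c E` is fixed by `P E`, hence constant by induction, and so is `c = (c E) P`.
lemma vecMul_one_jac (k : ℕ) :
    (fun _ => 1) ᵥ* (1 - jac (levelSys D (1 / Real.exp 1) k) (critWeight D k)) = 0 ∧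
    ∀ c : TreeClass D k → ℝ,
      c ᵥ* (1 - jac (levelSys D (1 / Real.exp 1) k) (critWeight D k)) = 0 →
        ∃ t : ℝ, c = t • fun _ => (1 : ℝ) := by
  induction k with
  | zero =>
    have h1 : jac (levelSys D (1 / Real.exp 1) 0) (critWeight D 0) = 1 := by
      ext i j
      rw [jac_levelSys_zero, ← (push_critWeight_and_eq D 0).1, Subsingleton.elim i j,
        Matrix.one_apply_eq]
      rfl
    rw [h1, sub_self]
    refine ⟨Matrix.vecMul_zero _, fun c _ => ⟨c default, funext fun i => ?_⟩⟩
    rw [Subsingleton.elim i default]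
    simp
  | succ k ih =>
    have hJ : jac (levelSys D (1 / Real.exp 1) k) (critWeight D k) =
        pushMatrix D k * jac (extend D (1 / Real.exp 1) k) (critWeight D k) :=
      jac_levelSys D _ k _
    rw [jac_levelSys_succ, (push_critWeight_and_eq D k).2]
    rw [hJ] at ih
    set P := pushMatrix D k
    set J := jac (extend D (1 / Real.exp 1) k) (critWeight D k)
    have hone : (fun _ => (1 : ℝ)) ᵥ* P = fun _ => 1 := by
      funext i
      simp [Matrix.vecMul, dotProduct, P, pushMatrix]
    obtain ⟨ih1, ih2⟩ := ih
    simp only [Matrix.vecMul_sub, Matrix.vecMul_one, sub_eq_zero, ← Matrix.vecMul_vecMul] at *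
    rw [hone] at ih1
    have hone' : (fun _ => (1 : ℝ)) ᵥ* J ᵥ* P = fun _ => 1 := by rw [← ih1, hone]
    refine ⟨hone'.symm, fun c hc => ?_⟩
    obtain ⟨t, ht⟩ := ih2 (c ᵥ* J) (by conv_lhs => rw [hc])
    refine ⟨t, ?_⟩
    rw [hc, ht, Matrix.smul_vecMul, hone]

end Perron

/-! ### The system of the pattern as an instance of `levelSys` -/

section Pattern

variable {W : Type*} [Fintype W] (M : SimpleGraph W)

/-- At `u = 1` the occurrences are forgotten and `terms M j` is a full fiber of the truncation, so
its monomials add up by the multinomial theorem. -/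
lemma evalAt_poly (y : Cls M → ℝ) (j : PosCls M) :
    evalAt M y 1 (poly M j) = wt (push (outDegrees M) (subHeight M) y) j.2 := by
  refine Eq.trans ?_ (sum_wt_map_eq y (trunc (outDegrees M) (subHeight M)) j.2)
  simp only [evalAt, poly, terms, map_sum, map_mul, map_prod, map_pow, MvPolynomial.aeval_X,
    MvPolynomial.aeval_C, Sum.elim_inl, Sum.elim_inr, one_pow, mul_one]
  refine Finset.sum_congr rfl fun s _ => ?_
  rw [wt, Finset.prod_div_distrib, div_eq_inv_mul]
  simp

lemma evalAt_polyU (y : Cls M → ℝ) (j : PosCls M) :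
    evalAt M y 1 (polyU M j) =
      ∑ m ∈ terms M j, wt y m * addOcc M (m : Multiset (Cls M)) := by
  simp only [evalAt, polyU, poly, map_sum]
  refine Finset.sum_congr rfl fun s _ => ?_
  have h1 : MvPolynomial.pderiv (R := ℚ) (Sum.inr () : Cls M ⊕ Unit)
      (∏ i : Cls M, MvPolynomial.X (Sum.inl i) ^ Multiset.count i (s : Multiset (Cls M))) = 0 := by
    classical
    refine Finset.induction_on (univ : Finset (Cls M)) (by simp) fun i t hi ih => ?_
    rw [Finset.prod_insert hi, MvPolynomial.pderiv_mul, ih, MvPolynomial.pderiv_pow,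
      MvPolynomial.pderiv_X_of_ne (by simp)]
    simp
  rw [mul_assoc, MvPolynomial.pderiv_C_mul, MvPolynomial.pderiv_mul, h1, MvPolynomial.pderiv_pow,
    MvPolynomial.pderiv_X_self]
  simp only [zero_mul, zero_add, mul_one, map_mul, map_prod, map_pow, MvPolynomial.aeval_X,
    MvPolynomial.aeval_C, Sum.elim_inl, Sum.elim_inr, one_pow, map_natCast]
  rw [wt, Finset.prod_div_distrib, div_eq_inv_mul]
  simp [mul_assoc]

lemma sysF_eq (x : ℝ) (a : Cls M → ℝ) :
    sysF M x a 1 = levelSys (outDegrees M) x (subHeight M + 1) a := by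
  funext i
  cases i with
  | none =>
    simp only [sysF, levelSys, extend, evalAt_poly, sum_branching_wt, sum_push]
  | some j => simp only [sysF, levelSys, extend, evalAt_poly]

lemma jacF_eq (x : ℝ) (a : Cls M → ℝ) :
    jacF M x a 1 = jac (levelSys (outDegrees M) x (subHeight M + 1)) a := by
  simp only [jacF, jac, sysF_eq]

lemma isNonnegSolution_critWeight :
    IsNonnegSolution M (1 / Real.exp 1) (critWeight (outDegrees M) (subHeight M + 1)) := by
  refine ⟨by positivity, fun i => (critWeight_pos _ _ i).le, ?_, ?_⟩
  · rw [sysF_eq]; exact (push_critWeight_and_eq _ _).1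
  · rw [jacF_eq]; exact det_one_sub_jac_critWeight _ _

lemma IsNonnegSolution.eq_critWeight {x : ℝ} {a : Cls M → ℝ} (h : IsNonnegSolution M x a) :
    x = 1 / Real.exp 1 ∧ a = critWeight (outDegrees M) (subHeight M + 1) := by
  obtain ⟨-, -, h1, h2⟩ := h
  rw [sysF_eq] at h1
  rw [jacF_eq] at h2
  exact TreePattern.eq_critWeight _ x _ a h1 h2

lemma isLeftPerronVector_one :
    IsLeftPerronVector
      (jacF M (1 / Real.exp 1) (critWeight (outDegrees M) (subHeight M + 1)) 1) fun _ => 1 := by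
  rw [jacF_eq]
  exact ⟨jac_levelSys_nonneg _ _, fun _ => one_pos, (vecMul_one_jac _ _).1, (vecMul_one_jac _ _).2⟩

/-- The sum of the `u`-derivatives, as a sum over all the multisets of classes. -/
lemma sum_evalAt_polyU (y : Cls M → ℝ) :
    ∑ j : PosCls M, evalAt M y 1 (polyU M j) =
      ∑ d ∈ outDegrees M, ∑ m : Sym (Cls M) d, wt y m * addOcc M (m : Multiset (Cls M)) := by
  simp only [evalAt_polyU, terms]
  rw [Fintype.sum_sigma, ← Finset.sum_coe_sort (outDegrees M)]
  refine Finset.sum_congr rfl fun d _ => ?_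
  exact Finset.sum_fiberwise (univ : Finset (Sym (Cls M) d))
    (fun m => m.map (trunc (outDegrees M) (subHeight M)))
    fun m => wt y m * addOcc M (m : Multiset (Cls M))

end Pattern

/-! ### Distances in trees, and matches as local isomorphisms -/

section Distances

variable {V W : Type*} {G : SimpleGraph V} {M : SimpleGraph W}

lemma exists_closer (hG : G.Connected) {x v : V} (h : v ≠ x) :
    ∃ u, G.Adj v u ∧ G.dist x u + 1 = G.dist x v := by
  obtain ⟨p, hp⟩ := hG.exists_walk_length_eq_dist v x
  cases p with
  | nil => exact absurd rfl h
  | @cons _ u _ huv q =>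
    refine ⟨u, huv, ?_⟩
    have h1 : G.dist u x ≤ q.length := SimpleGraph.dist_le q
    have h2 := hG.dist_triangle (u := v) (v := u) (w := x)
    rw [SimpleGraph.dist_eq_one_iff_adj.mpr huv] at h2
    rw [SimpleGraph.Walk.length_cons] at hp
    rw [SimpleGraph.dist_comm (u := x), SimpleGraph.dist_comm (u := x)]
    omega

/-- Each closer neighbor is the last but one node of a shortest walk from `x` to `v`, and a tree has
only one path between them. -/
lemma closer_unique (hG : G.IsTree) {x v u u' : V} (hu : G.Adj v u) (hu' : G.Adj v u')
    (h : G.dist x u + 1 = G.dist x v) (h' : G.dist x u' + 1 = G.dist x v) : u = u' := by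
  have key : ∀ {y} (hy : G.Adj v y), G.dist x y + 1 = G.dist x v →
      ∃ p : G.Walk x v, p.IsPath ∧ p.penultimate = y := by
    intro y hy hd
    obtain ⟨p, hp⟩ := hG.connected.exists_walk_length_eq_dist x y
    refine ⟨p.concat hy.symm, ?_, by simp⟩
    refine SimpleGraph.Walk.isPath_of_length_eq_dist _ ?_
    rw [SimpleGraph.Walk.length_concat, hp, hd]
  obtain ⟨p, hp, rfl⟩ := key hu h
  obtain ⟨q, hq, rfl⟩ := key hu' h'
  rw [(hG.existsUnique_path x v).unique hp hq]

lemma dist_add_one_of_ne_closer (hG : G.IsTree) {x v u u' : V} (hu : G.Adj v u)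
    (hu' : G.Adj v u') (h : G.dist x u + 1 = G.dist x v) (hne : u' ≠ u) :
    G.dist x u' = G.dist x v + 1 := by
  rcases hG.dist_eq_dist_add_one_of_adj x hu' with h1 | h1
  · exact absurd (closer_unique hG hu' hu h1.symm h) hne
  · exact h1

lemma isInternal_iff [Finite W] {w : W} :
    IsInternal M w ↔ ∃ a b, M.Adj w a ∧ M.Adj w b ∧ a ≠ b := by
  rw [IsInternal, Nat.succ_le_iff, Set.one_lt_ncard (Set.toFinite _)]
  simp only [SimpleGraph.mem_neighborSet]
  constructor
  · rintro ⟨a, ha, b, hb, h⟩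
    exact ⟨a, b, ha, hb, h⟩
  · rintro ⟨a, b, ha, hb, h⟩
    exact ⟨a, ha, b, hb, h⟩

lemma eq_of_not_isInternal [Finite W] {w a b : W} (hw : ¬ IsInternal M w) (ha : M.Adj w a)
    (hb : M.Adj w b) : a = b := by
  by_contra h
  exact hw (isInternal_iff.mpr ⟨a, b, ha, hb, h⟩)

/-- Two adjacent external nodes would have no further neighbors and would, by connectedness, be the
whole tree. -/
lemma isInternal_or_of_adj [Fintype W] (hM : M.IsTree) (hW : 3 ≤ Fintype.card W) {u v : W}
    (h : M.Adj u v) : IsInternal M u ∨ IsInternal M v := by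
  classical
  by_contra! hno
  have key : ∀ n x, M.dist u x = n → x = u ∨ x = v := by
    intro n
    induction n with
    | zero =>
      intro x hx
      exact Or.inl (hM.connected.dist_eq_zero_iff.mp hx).symm
    | succ n ih =>
      intro x hx
      have hxu : x ≠ u := by rintro rfl; simp at hx
      obtain ⟨y, hy, hd⟩ := exists_closer hM.connected hxu
      rcases ih y (by omega) with rfl | rfl
      · exact Or.inr (eq_of_not_isInternal hno.1 hy.symm h)
      · exact Or.inl (eq_of_not_isInternal hno.2 hy.symm h.symm)
  have h1 : (univ : Finset W) ⊆ {u, v} := fun x _ => by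
    simpa using key _ x rfl
  have h2 := Finset.card_le_card h1
  have h3 := Finset.card_le_two (a := u) (b := v)
  rw [Finset.card_univ] at h2
  omega

/-- `f` maps the neighbors of each internal node bijectively onto the neighbors of its image. -/
def LocalIso (M : SimpleGraph W) (G : SimpleGraph V) (f : W → V) : Prop :=
  ∀ w, IsInternal M w → Set.BijOn f (M.neighborSet w) (G.neighborSet (f w))

lemma LocalIso.adj [Fintype W] (hM : M.IsTree) (hW : 3 ≤ Fintype.card W) {f : W → V}
    (hf : LocalIso M G f) {u v : W} (h : M.Adj u v) : G.Adj (f u) (f v) := by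
  rcases isInternal_or_of_adj hM hW h with hu | hv
  · exact (hf u hu).mapsTo h
  · exact ((hf v hv).mapsTo h.symm).symm

/-- An inner node of a path in `M` is internal, so `f` is injective on its neighbors and the image
path does not turn back; in a tree a walk that never turns back is shortest. -/
lemma LocalIso.dist_eq [Fintype W] (hM : M.IsTree) (hG : G.IsTree) (hW : 3 ≤ Fintype.card W)
    {f : W → V} (hf : LocalIso M G f) (x y : W) : G.dist (f x) (f y) = M.dist x y := by
  suffices ∀ n y, M.dist x y = n → G.dist (f x) (f y) = M.dist x y from this _ y rfl
  intro n
  induction n using Nat.strong_induction_on with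
  | _ n ih =>
    intro y hy
    by_cases hxy : y = x
    · simp [hxy]
    obtain ⟨z, hz, hd⟩ := exists_closer hM.connected hxy
    have h1 := ih _ (by omega) z rfl
    by_cases hxz : z = x
    · subst hxz
      rw [SimpleGraph.dist_eq_one_iff_adj.mpr (hf.adj hM hW hz.symm),
        SimpleGraph.dist_eq_one_iff_adj.mpr hz.symm]
    obtain ⟨t, ht, hd'⟩ := exists_closer hM.connected hxz
    have h2 := ih _ (by omega) t rfl
    have hty : t ≠ y := by rintro rfl; omega
    have hint : IsInternal M z := isInternal_iff.mpr ⟨t, y, ht, hz.symm, hty⟩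
    have hne : f y ≠ f t := fun h => hty ((hf z hint).injOn ht hz.symm h.symm)
    rw [dist_add_one_of_ne_closer hG (hf.adj hM hW ht) (hf.adj hM hW hz.symm)
      (by rw [h1, h2, hd']) hne, h1, hd]

/-- A local isomorphism of a tree to a tree is an embedding. -/
noncomputable def LocalIso.toEmbedding [Fintype W] (hM : M.IsTree) (hG : G.IsTree)
    (hW : 3 ≤ Fintype.card W) {f : W → V} (hf : LocalIso M G f) : M ↪g G where
  toFun := f
  inj' x y h := by
    rw [← hM.connected.dist_eq_zero_iff, ← hf.dist_eq hM hG hW, h, SimpleGraph.dist_self]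
  map_rel_iff' {x y} := by
    change G.Adj (f x) (f y) ↔ M.Adj x y
    rw [← SimpleGraph.dist_eq_one_iff_adj, hf.dist_eq hM hG hW, SimpleGraph.dist_eq_one_iff_adj]

lemma degree_eq_ncard [Fintype V] (G : SimpleGraph V) (v : V) [Fintype (G.neighborSet v)] :
    G.degree v = (G.neighborSet v).ncard := by
  rw [← SimpleGraph.card_neighborSet_eq_degree, ← Nat.card_eq_fintype_card, Nat.card_coe_set_eq]

lemma isMatch_iff_localIso [Fintype W] [Fintype V] (f : M ↪g G) :
    IsMatch M G f ↔ LocalIso M G f := by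
  refine forall₂_congr fun w _ => ?_
  rw [degree_eq_ncard, degree_eq_ncard]
  have hmaps : Set.MapsTo f (M.neighborSet w) (G.neighborSet (f w)) := fun x hx =>
    f.map_adj_iff.mpr hx
  have hinj : Set.InjOn f (M.neighborSet w) := f.injective.injOn
  constructor
  · intro h
    refine ⟨hmaps, hinj, ?_⟩
    refine (Set.eq_of_subset_of_ncard_le hmaps.image_subset ?_).symm.subset
    rw [hinj.ncard_image, h]
  · intro h
    rw [← h.image_eq, hinj.ncard_image]

end Distances

/-! ### Rooted trees as parent functions -/

section Parents

variable {V : Type*}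

/-- `g` maps every node of some tree with root `r` to its parent, and the root to itself. -/
def IsParent (g : V → V) (r : V) : Prop :=
  g r = r ∧ ∀ S : Set V, S.Nonempty → r ∉ S → ∃ a ∈ S, g a ∉ S

/-- The graph that joins every node to its parent. -/
def parentGraph (g : V → V) : SimpleGraph V where
  Adj u v := u ≠ v ∧ (g u = v ∨ g v = u)
  symm := ⟨fun _ _ h => ⟨h.1.symm, h.2.symm⟩⟩
  loopless := ⟨fun _ h => h.1 rfl⟩

open Classical in
/-- The neighbor of `v` on the path to `r`, and `r` if `v = r`. -/
noncomputable def toward (G : SimpleGraph V) (r v : V) : V :=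
  if h : ∃ u, G.Adj v u ∧ G.dist r u + 1 = G.dist r v then h.choose else r

lemma toward_self (G : SimpleGraph V) (r : V) : toward G r r = r := by
  rw [toward, dif_neg]
  rintro ⟨u, -, h⟩
  simp at h

lemma toward_spec {G : SimpleGraph V} (hG : G.Connected) {r v : V} (h : v ≠ r) :
    G.Adj v (toward G r v) ∧ G.dist r (toward G r v) + 1 = G.dist r v := by
  have := exists_closer hG h
  rw [toward, dif_pos this]
  exact this.choose_spec

lemma toward_eq {G : SimpleGraph V} (hG : G.IsTree) {r v u : V} (hu : G.Adj v u)
    (h : G.dist r u + 1 = G.dist r v) : toward G r v = u := by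
  have hv : v ≠ r := by rintro rfl; simp at h
  have := toward_spec hG.connected hv
  exact closer_unique hG this.1 hu this.2 h

lemma isParent_toward {G : SimpleGraph V} (hG : G.Connected) (r : V) : IsParent (toward G r) r := by
  refine ⟨toward_self G r, fun S hS hr => ?_⟩
  obtain ⟨a, ha, hmin⟩ := WellFounded.has_min (measure (G.dist r)).wf S hS
  refine ⟨a, ha, fun h => hmin _ h ?_⟩
  have har : a ≠ r := by rintro rfl; exact hr ha
  have := (toward_spec hG har).2
  change G.dist r _ < G.dist r _
  omega

lemma parentGraph_toward {G : SimpleGraph V} (hG : G.IsTree) (r : V) :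
    parentGraph (toward G r) = G := by
  have key : ∀ {u v}, u ≠ v → toward G r u = v → G.Adj u v := by
    rintro u v huv rfl
    by_cases h : u = r
    · subst h
      exact absurd (toward_self G u).symm huv
    · exact (toward_spec hG.connected h).1
  ext u v
  constructor
  · rintro ⟨huv, h | h⟩
    · exact key huv h
    · exact (key huv.symm h).symm
  · intro h
    refine ⟨h.ne, ?_⟩
    rcases hG.dist_eq_dist_add_one_of_adj r h with hd | hd
    · exact Or.inl (toward_eq hG h hd.symm)
    · exact Or.inr (toward_eq hG h.symm hd.symm)

lemma IsParent.ne_self {g : V → V} {r : V} (hg : IsParent g r) {v : V} (hv : v ≠ r) : g v ≠ v := by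
  obtain ⟨a, rfl, ha⟩ := hg.2 {v} ⟨v, rfl⟩ (by simpa using hv.symm)
  exact ha

/-- A nonempty set of nodes not reachable from `r` would contain a node with a reachable parent, so
the graph is connected. Each edge joins some `v ≠ r` to `g v`, so there are at most `|V| - 1` edges.
-/
lemma IsParent.isTree [Finite V] {g : V → V} {r : V} (hg : IsParent g r) :
    (parentGraph g).IsTree := by
  classical
  have hreach : ∀ v, (parentGraph g).Reachable r v := by
    by_contra! h
    obtain ⟨a, ha, hga⟩ := hg.2 {v | ¬ (parentGraph g).Reachable r v} h (by simp)
    have har : a ≠ r := by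
      rintro rfl
      exact ha (SimpleGraph.Reachable.refl _)
    simp only [Set.mem_ofPred_eq, not_not] at hga
    exact ha (hga.trans (SimpleGraph.Adj.reachable ⟨hg.ne_self har, Or.inr rfl⟩))
  have hconn : (parentGraph g).Connected :=
    { preconnected := fun u v => (hreach u).symm.trans (hreach v)
      nonempty := ⟨r⟩ }
  rw [SimpleGraph.isTree_iff_connected_and_card]
  refine ⟨hconn, le_antisymm ?_ hconn.card_vert_le_card_edgeSet_add_one⟩
  have hsub : (parentGraph g).edgeSet ⊆ (fun v => s(v, g v)) '' {v | v ≠ r} := by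
    intro e he
    induction e with
    | _ u v =>
      rw [SimpleGraph.mem_edgeSet] at he
      have key : ∀ {u v}, u ≠ v → g u = v → u ≠ r := by
        rintro u v huv rfl rfl
        exact huv hg.1.symm
      rcases he with ⟨huv, h | h⟩
      · exact ⟨u, key huv h, by simp [h]⟩
      · exact ⟨v, key huv.symm h, by simp [h, Sym2.eq_swap]⟩
  have h1 : (parentGraph g).edgeSet.ncard ≤ ({v | v ≠ r} : Set V).ncard :=
    (Set.ncard_le_ncard hsub (Set.toFinite _)).trans (Set.ncard_image_le (Set.toFinite _))
  have h2 : ({v | v ≠ r} : Set V).ncard + 1 = Nat.card V := by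
    rw [show {v | v ≠ r} = ({r} : Set V)ᶜ from rfl, ← Set.ncard_singleton r, add_comm,
      Set.ncard_add_ncard_compl]
  rw [Nat.card_coe_set_eq]
  omega

/-- If the neighbor `u` of `v` towards `r` were a child of `v`, then by induction on the distance
`v` would be the neighbor of `u` towards `r`, against the order of the distances. -/
lemma IsParent.toward_parentGraph [Finite V] {g : V → V} {r : V} (hg : IsParent g r) :
    toward (parentGraph g) r = g := by
  have hT := hg.isTree
  suffices ∀ n v, (parentGraph g).dist r v = n → toward (parentGraph g) r v = g v from
    funext fun v => this _ v rfl
  intro n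
  induction n using Nat.strong_induction_on with
  | _ n ih =>
    intro v hv
    by_cases hvr : v = r
    · subst hvr
      rw [toward_self, hg.1]
    obtain ⟨⟨hne, hadj⟩, hd⟩ := toward_spec hT.connected hvr
    set u := toward (parentGraph g) r v
    rcases hadj with h | h
    · exact h.symm
    · exfalso
      have hu := ih _ (by omega) u rfl
      by_cases hur : u = r
      · rw [hur, hg.1] at h
        exact hvr h.symm
      · have := (toward_spec hT.connected hur).2
        rw [hu, h] at this
        omega

end Parents

/-! ### Maps of a branch of the pattern, and their recursion -/

section Branches

variable {V W : Type*} [Fintype V] [Fintype W] {M : SimpleGraph W} {G : SimpleGraph V}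

/-- `x` lies in the branch of `M` that starts with the step from `q` to its neighbor `w`. -/
def InBranch (M : SimpleGraph W) (q w x : W) : Prop := M.dist x w + 1 = M.dist x q

lemma inBranch_self {q w : W} (h : M.Adj q w) : InBranch M q w w := by
  rw [InBranch, SimpleGraph.dist_self, SimpleGraph.dist_eq_one_iff_adj.mpr h.symm]

lemma not_inBranch_left (q w : W) : ¬ InBranch M q w q := by
  simp [InBranch]

lemma InBranch.toward_eq (hM : M.IsTree) {q w x : W} (h : M.Adj q w) (hx : InBranch M q w x) :
    toward M x q = w := TreePattern.toward_eq hM h hx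

lemma inBranch_toward (hM : M.IsTree) {q x : W} (h : q ≠ x) : InBranch M q (toward M x q) x :=
  (toward_spec hM.connected h).2

lemma not_inBranch_iff (hM : M.IsTree) {q w x : W} (h : M.Adj q w) :
    ¬ InBranch M q w x ↔ InBranch M w q x := by
  rcases hM.dist_eq_dist_add_one_of_adj x h with h1 | h1 <;> simp only [InBranch] <;> omega

lemma mem_children {p v c : V} : c ∈ children G p v ↔ G.Adj v c ∧ c ≠ p := by
  classical
  rw [children, Finset.mem_erase, SimpleGraph.mem_neighborFinset, and_comm]

lemma InBranch.of_child (hM : M.IsTree) {q w c x : W} (h : M.Adj q w) (hc : c ∈ children M q w)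
    (hx : InBranch M w c x) : InBranch M q w x := by
  rw [mem_children] at hc
  exact (dist_add_one_of_ne_closer hM hc.1 h.symm hx hc.2.symm).symm

lemma InBranch.toward_mem_children (hM : M.IsTree) {q w x : W} (hx : InBranch M q w x)
    (hxw : x ≠ w) : toward M x w ∈ children M q w := by
  rw [mem_children]
  obtain ⟨h1, h2⟩ := toward_spec hM.connected hxw.symm
  refine ⟨h1, fun h => ?_⟩
  rw [h] at h2
  rw [InBranch] at hx
  omega

lemma toward_mem_children_iff (hM : M.IsTree) {q w x : W} (h : M.Adj q w) :
    toward M x w ∈ children M q w ↔ InBranch M q w x ∧ x ≠ w := by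
  constructor
  · intro hc
    have hxw : w ≠ x := by
      rintro rfl
      rw [toward_self, mem_children] at hc
      exact hc.1.ne rfl
    exact ⟨(inBranch_toward hM hxw).of_child hM h hc, hxw.symm⟩
  · exact fun hx => hx.1.toward_mem_children hM hx.2

lemma InBranch.ne_left {q w x : W} (hx : InBranch M q w x) : x ≠ q := by
  rintro rfl
  exact not_inBranch_left _ _ hx

/-- The only way out of a branch leads through its first step. -/
lemma InBranch.eq_of_adj (hM : M.IsTree) {q w x y : W} (h : M.Adj q w) (hx : InBranch M q w x)
    (hxy : M.Adj x y) (hy : ¬ InBranch M q w y) : y = q := by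
  rw [not_inBranch_iff hM h] at hy
  have hw := hM.dist_eq_dist_add_one_of_adj w hxy
  have hq := hM.dist_eq_dist_add_one_of_adj q hxy
  simp only [InBranch, SimpleGraph.dist_comm (u := x), SimpleGraph.dist_comm (u := y)] at hx hy
  have h1 : M.dist q y + 1 = M.dist q x := by omega
  by_cases hxw : x = w
  · subst hxw
    rw [SimpleGraph.dist_self, zero_add] at hx
    have : M.dist q y = 0 := by omega
    exact (hM.connected.dist_eq_zero_iff.mp this).symm
  · exfalso
    obtain ⟨z, hz, hd⟩ := exists_closer hM.connected hxw
    have htri := hM.connected.dist_triangle (u := q) (v := w) (w := z)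
    rw [SimpleGraph.dist_eq_one_iff_adj.mpr h] at htri
    have hq' := hM.dist_eq_dist_add_one_of_adj q hz
    have := closer_unique hM (x := q) hz hxy (by omega) h1
    subst this
    omega

open Classical in
/-- The maps of the branch of `M` at the step from `q` to `w` to `G`, with `q` mapped to `p` and `w`
to `v`, that are bijective on the neighbors of the internal nodes. All the nodes outside of the
branch are mapped to `p`. -/
noncomputable def branchMaps (M : SimpleGraph W) (G : SimpleGraph V) (q w : W) (p v : V) :
    Finset (W → V) :=
  univ.filter fun f => (∀ x, ¬ InBranch M q w x → f x = p) ∧ f w = v ∧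
    ∀ x, InBranch M q w x → IsInternal M x →
      Set.BijOn f (M.neighborSet x) (G.neighborSet (f x))

lemma mem_branchMaps {q w : W} {p v : V} {f : W → V} :
    f ∈ branchMaps M G q w p v ↔ (∀ x, ¬ InBranch M q w x → f x = p) ∧ f w = v ∧
      ∀ x, InBranch M q w x → IsInternal M x →
        Set.BijOn f (M.neighborSet x) (G.neighborSet (f x)) := by
  simp [branchMaps]

open Classical in
/-- Gluing maps of the branches below `w` to a map of the branch at `w`. -/
noncomputable def glue (M : SimpleGraph W) (q w : W) (p v : V) (g : children M q w → W → V) :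
    W → V := fun x =>
  if h : toward M x w ∈ children M q w then g ⟨_, h⟩ x else if x = w then v else p

lemma glue_self (q w : W) (p v : V) (g : children M q w → W → V) : glue M q w p v g w = v := by
  rw [glue, dif_neg, if_pos rfl]
  rw [toward_self, mem_children]
  exact fun h => h.1.ne rfl

lemma glue_of_inBranch (hM : M.IsTree) {q w : W} (p v : V) (g : children M q w → W → V)
    (c : children M q w) {x : W} (hx : InBranch M w c x) : glue M q w p v g x = g c x := by
  have h1 : toward M x w = c := hx.toward_eq hM (mem_children.mp c.2).1
  have h2 : toward M x w ∈ children M q w := h1 ▸ c.2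
  rw [glue, dif_pos h2]
  congr 1
  congr 1

lemma glue_of_not_inBranch (hM : M.IsTree) {q w : W} (h : M.Adj q w) (p v : V)
    (g : children M q w → W → V) {x : W} (hx : ¬ InBranch M q w x) : glue M q w p v g x = p := by
  rw [glue, dif_neg fun hc => hx ((toward_mem_children_iff hM h).mp hc).1, if_neg]
  rintro rfl
  exact hx (inBranch_self h)

lemma neighborSet_eq_insert_children {p v : V} (h : G.Adj p v) :
    G.neighborSet v = insert p (children G p v : Set V) := by
  ext c
  rw [Set.mem_insert_iff, Finset.mem_coe, mem_children, SimpleGraph.mem_neighborSet]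
  constructor
  · intro hc
    by_cases hcp : c = p
    · exact Or.inl hcp
    · exact Or.inr ⟨hc, hcp⟩
  · rintro (rfl | hc)
    · exact h.symm
    · exact hc.1

lemma notMem_children {p v : V} : p ∉ (children G p v : Set V) := by
  rw [Finset.mem_coe, mem_children]
  exact fun h => h.2 rfl

lemma glue_mem_branchMaps (hM : M.IsTree) {q w : W} (h : M.Adj q w) {p v : V} (hpv : G.Adj p v)
    (β : children M q w ≃ children G p v) (g : children M q w → W → V)
    (hg : ∀ c : children M q w, g c ∈ branchMaps M G w c v (β c)) :
    glue M q w p v g ∈ branchMaps M G q w p v := by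
  simp only [mem_branchMaps] at hg
  refine mem_branchMaps.mpr ⟨fun x hx => glue_of_not_inBranch hM h p v g hx,
    glue_self q w p v g, fun x hx hint => ?_⟩
  have hchild : ∀ c : children M q w, glue M q w p v g c = β c := fun c => by
    rw [glue_of_inBranch hM p v g c (inBranch_self (mem_children.mp c.2).1), (hg c).2.1]
  by_cases hxw : x = w
  · subst hxw
    rw [glue_self, neighborSet_eq_insert_children h, neighborSet_eq_insert_children hpv]
    have hq : glue M q x p v g q = p := glue_of_not_inBranch hM h p v g (not_inBranch_left q x)
    have hb : Set.BijOn (glue M q x p v g) (children M q x : Set W) (children G p v : Set V) := by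
      refine ⟨fun c hc => ?_, fun c hc c' hc' hcc => ?_, fun y hy => ?_⟩
      · rw [hchild ⟨c, hc⟩]; exact (β _).2
      · rw [hchild ⟨c, hc⟩, hchild ⟨c', hc'⟩] at hcc
        exact congrArg Subtype.val (β.injective (Subtype.ext hcc))
      · refine ⟨β.symm ⟨y, hy⟩, (β.symm ⟨y, hy⟩).2, ?_⟩
        rw [hchild, Equiv.apply_symm_apply]
    have := hb.insert (a := q) (by rw [hq]; exact notMem_children)
    rwa [hq] at this
  · have hc := hx.toward_mem_children hM hxw
    have hxc : InBranch M w (⟨_, hc⟩ : children M q w) x := inBranch_toward hM (Ne.symm hxw)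
    generalize (⟨_, hc⟩ : children M q w) = c at hxc
    have hwc : M.Adj w c := (mem_children.mp c.2).1
    rw [glue_of_inBranch hM p v g c hxc]
    refine ((hg c).2.2 x hxc hint).congr fun y hy => ?_
    by_cases hyc : InBranch M w c y
    · rw [glue_of_inBranch hM p v g c hyc]
    · rw [(hg c).1 y hyc, hxc.eq_of_adj hM hwc hy hyc, glue_self]

/-- A map of the branch amounts to a bijection between the children of `w` and of `v`, together with
a map of each sub-branch. The fixed value outside a branch keeps the count from depending on nodes
that play no role. -/
lemma card_branchMaps [DecidableEq V] [DecidableEq W] (hM : M.IsTree) {q w : W} (h : M.Adj q w)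
    (hw : IsInternal M w)
    {p v : V} (hpv : G.Adj p v) :
    #(branchMaps M G q w p v) = ∑ β : children M q w ≃ children G p v,
      ∏ c : children M q w, #(branchMaps M G w c v (β c)) := by
  classical
  simp only [← Fintype.card_piFinset]
  rw [← Finset.card_sigma]
  symm
  refine Finset.card_bij (fun s _ => glue M q w p v s.2) ?_ ?_ ?_
  · rintro ⟨β, g⟩ hg
    rw [Finset.mem_sigma] at hg
    exact glue_mem_branchMaps hM h hpv β g (Fintype.mem_piFinset.mp hg.2)
  · rintro ⟨β, g⟩ hg ⟨β', g'⟩ hg' heq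
    simp only [Finset.mem_sigma, Finset.mem_univ, true_and, Fintype.mem_piFinset,
      mem_branchMaps] at hg hg' heq
    have hgg : ∀ (c : children M q w) x, InBranch M w c x → g c x = g' c x := fun c x hx => by
      rw [← glue_of_inBranch hM p v g c hx, ← glue_of_inBranch hM p v g' c hx, heq]
    have h1 : g = g' := by
      funext c x
      by_cases hx : InBranch M w c x
      · exact hgg c x hx
      · rw [(hg c).1 x hx, (hg' c).1 x hx]
    have h2 : β = β' := by
      ext c
      rw [← (hg c).2.1, ← (hg' c).2.1, h1]
    rw [h1, h2]
  · intro f hf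
    rw [mem_branchMaps] at hf
    obtain ⟨hf1, hf2, hf3⟩ := hf
    have hq : f q = p := hf1 q (not_inBranch_left q w)
    have hbij := hf3 w (inBranch_self h) hw
    rw [hf2, neighborSet_eq_insert_children h, neighborSet_eq_insert_children hpv] at hbij
    have hb : Set.BijOn f (children M q w : Set W) (children G p v : Set V) := by
      have h3 := hbij.sdiff_singleton (Set.mem_insert q _)
      rwa [hq, Set.insert_sdiff_self_of_notMem notMem_children,
        Set.insert_sdiff_self_of_notMem notMem_children] at h3
    let β : children M q w ≃ children G p v := hb.equiv f
    have hβ : ∀ c, (β c : V) = f c := fun c => rfl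
    let g : children M q w → W → V := fun c x => if InBranch M w c x then f x else v
    refine ⟨⟨β, g⟩, ?_, ?_⟩
    · simp only [Finset.mem_sigma, Finset.mem_univ, true_and, Fintype.mem_piFinset]
      intro c
      have hwc : M.Adj w c := (mem_children.mp c.2).1
      refine mem_branchMaps.mpr ⟨fun x hx => if_neg hx, ?_, fun x hx hint => ?_⟩
      · rw [hβ]; exact if_pos (inBranch_self hwc)
      · have hgx : g c x = f x := if_pos hx
        rw [hgx]
        refine (hf3 x (hx.of_child hM h c.2) hint).congr fun y hy => ?_
        by_cases hyc : InBranch M w c y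
        · exact (if_pos hyc).symm
        · rw [hx.eq_of_adj hM hwc hy hyc, hf2]
          exact (if_neg (not_inBranch_left _ _)).symm
    · funext x
      by_cases hx : InBranch M q w x
      · by_cases hxw : x = w
        · subst hxw
          exact (glue_self _ _ _ _ _).trans hf2.symm
        · have hc := hx.toward_mem_children hM hxw
          have hxc : InBranch M w (⟨_, hc⟩ : children M q w) x := inBranch_toward hM (Ne.symm hxw)
          exact (glue_of_inBranch hM p v g _ hxc).trans (if_pos hxc)
      · exact (glue_of_not_inBranch hM h p v g hx).trans (hf1 x hx).symm

lemma card_branchMaps_of_not_isInternal (hM : M.IsTree) {q w : W} (h : M.Adj q w)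
    (hw : ¬ IsInternal M w) (p v : V) : #(branchMaps M G q w p v) = 1 := by
  classical
  have hB : ∀ x, InBranch M q w x → x = w := by
    intro x hx
    by_contra hxw
    have hc := mem_children.mp (hx.toward_mem_children hM hxw)
    exact hw (isInternal_iff.mpr ⟨_, q, hc.1, h.symm, hc.2⟩)
  rw [Finset.card_eq_one]
  refine ⟨fun x => if x = w then v else p, ?_⟩
  ext f
  rw [mem_branchMaps, Finset.mem_singleton]
  constructor
  · rintro ⟨h1, h2, -⟩
    funext x
    by_cases hx : x = w
    · rw [if_pos hx, hx, h2]
    · rw [if_neg hx, h1 x fun hx' => hx (hB x hx')]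
  · rintro rfl
    refine ⟨fun x hx => if_neg ?_, if_pos rfl, fun x hx hint => absurd (hB x hx ▸ hint) hw⟩
    rintro rfl
    exact hx (inBranch_self h)

end Branches

/-! ### Counting branch maps by classes, and their critical weight -/

section Counts

variable {V W : Type*} [Fintype V] [Fintype W] {M : SimpleGraph W} {G : SimpleGraph V}

open Classical in
/-- The sum of the products of `e c`, over all the ways to assign the members of `s` to the members
`c` of `C`. -/
noncomputable def forestCount {α : Type*} [Fintype α] [DecidableEq α] (C : Finset W)
    (e : W → α → ℕ) (s : Multiset α) : ℕ :=
  symmFactor s * ∑ h : C → α with (univ : Finset C).val.map h = s, ∏ c : C, e c (h c)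

lemma forestCount_eq_zero {α : Type*} [Fintype α] [DecidableEq α] (C : Finset W)
    (e : W → α → ℕ) (s : Multiset α) (hs : s.card ≠ #C) : forestCount C e s = 0 := by
  classical
  rw [forestCount, Finset.filter_false_of_mem, Finset.sum_empty, mul_zero]
  rintro h - rfl
  rw [Multiset.card_map] at hs
  exact hs (Finset.card_univ.trans (Fintype.card_coe C))

/-- Only `d = #C` contributes. The symmetry factor in `forestCount` cancels the one in `wt`, leaving
a sum over all functions on `C`, which factors. -/
lemma sum_wt_mul_forestCount {α : Type*} [Fintype α] [DecidableEq α] (C : Finset W)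
    (e : W → α → ℕ) (y : α → ℝ) (D : Finset ℕ) (hC : #C ∈ D) :
    ∑ d ∈ D, ∑ s : Sym α d, wt y s * forestCount C e (s : Multiset α) =
      ∏ c ∈ C, ∑ i, y i * e c i := by
  classical
  rw [Finset.sum_eq_single_of_mem _ hC]
  · rw [← Finset.prod_coe_sort C, Finset.prod_univ_sum, Fintype.piFinset_univ]
    let T : (C → α) → Sym α #C := fun h => ⟨(univ : Finset C).val.map h,
      (Multiset.card_map _ _).trans (Finset.card_univ.trans (Fintype.card_coe C))⟩
    rw [← Finset.sum_fiberwise (s := (univ : Finset (C → α))) (g := T)]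
    refine Finset.sum_congr rfl fun s _ => ?_
    have h1 : ∀ h : C → α, T h = s ↔ (univ : Finset C).val.map h = (s : Multiset α) :=
      fun h => Subtype.ext_iff
    simp only [h1, forestCount]
    have hpos : (symmFactor (s : Multiset α) : ℝ) ≠ 0 := by exact_mod_cast (symmFactor_pos _).ne'
    push_cast
    rw [wt_eq, ← mul_assoc, div_mul_cancel₀ _ hpos, Finset.mul_sum]
    refine Finset.sum_congr rfl fun h hh => ?_
    rw [← (Finset.mem_filter.mp hh).2, Multiset.map_map, Finset.prod_mul_distrib]
    rfl
  · intro d _ hd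
    refine Finset.sum_eq_zero fun s _ => ?_
    rw [forestCount_eq_zero C e s (fun h => hd (s.2.symm.trans h)), Nat.cast_zero, mul_zero]

/-- The number of ways to map the branch of `M` at the step from `q` to `w` to a planted tree of
class `c`. -/
noncomputable def branchCount (M : SimpleGraph W) (D : Finset ℕ) :
    (k : ℕ) → W → W → TreeClass D k → ℕ
  | 0, _, _, _ => 1
  | k + 1, q, w, c =>
    haveI := Classical.dec (IsInternal M w)
    if IsInternal M w then
      Option.elim (α := Branching D k) c 0 fun j =>
        forestCount (children M q w) (branchCount M D k w) (j.2 : Multiset (TreeClass D k))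
    else 1

lemma card_children {q w : W} [Fintype (M.neighborSet w)] (h : M.Adj q w) :
    #(children M q w) = M.degree w - 1 := by
  classical
  rw [children, Finset.card_erase_of_mem (by simpa using h.symm), SimpleGraph.card_neighborFinset_eq_degree]
  congr!

lemma card_children_mem_outDegrees {q w : W} (h : M.Adj q w) (hw : IsInternal M w) :
    #(children M q w) ∈ outDegrees M := by
  classical
  rw [card_children h, outDegrees]
  refine Finset.mem_image.mpr ⟨w, by simpa using hw, ?_⟩
  congr!

lemma map_univ_coe_finset {α β : Type*} (S : Finset α) (F : α → β) :
    (univ : Finset S).val.map (fun y : S => F y) = S.val.map F := by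
  have : (univ : Finset S).val.map (Subtype.val : S → α) = S.val := by
    rw [Finset.univ_eq_attach]
    exact Multiset.attach_map_val _
  conv_rhs => rw [← this, Multiset.map_map]
  rfl

lemma dist_le_of_child {q w c x : W} (hM : M.IsTree) {k : ℕ} (h : M.Adj q w)
    (hk : ∀ x, InBranch M q w x → M.dist w x ≤ k + 1) (hc : c ∈ children M q w)
    (hx : InBranch M w c x) : M.dist c x ≤ k := by
  have h1 := hk x (hx.of_child hM h hc)
  rw [InBranch, SimpleGraph.dist_comm (u := x), SimpleGraph.dist_comm (u := x)] at hx
  omega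

lemma not_isInternal_of_dist_le_zero {q w : W} (hM : M.IsTree) (h : M.Adj q w)
    (hk : ∀ x, InBranch M q w x → M.dist w x ≤ 0) : ¬ IsInternal M w := by
  intro hw
  obtain ⟨a, b, ha, hb, hab⟩ := isInternal_iff.mp hw
  obtain ⟨c, hc, hcq⟩ : ∃ c, M.Adj w c ∧ c ≠ q := by
    by_cases haq : a = q
    · exact ⟨b, hb, fun hbq => hab (haq.trans hbq.symm)⟩
    · exact ⟨a, ha, haq⟩
  have := hk c ((inBranch_self hc).of_child hM h (mem_children.mpr ⟨hc, hcq⟩))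
  rw [SimpleGraph.dist_eq_one_iff_adj.mpr hc] at this
  omega

lemma card_branchMaps_eq_forestCount (hM : M.IsTree) {α : Type*} [Fintype α] [DecidableEq α]
    {q w : W} (h : M.Adj q w) (hw : IsInternal M w) {p v : V} (hpv : G.Adj p v)
    (cl : V → α) (e : W → α → ℕ)
    (he : ∀ c ∈ children M q w, ∀ y ∈ children G p v,
      #(branchMaps M G w c v y) = e c (cl y)) :
    #(branchMaps M G q w p v) =
      forestCount (children M q w) e ((children G p v).val.map cl) := by
  classical
  rw [card_branchMaps hM h hw hpv]
  have h1 := sum_equiv_comp (X := children M q w) (Y := children G p v) (fun y : children G p v => cl y)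
    fun h => ∏ c : children M q w, e c (h c)
  rw [map_univ_coe_finset] at h1
  rw [forestCount]
  simp only [Nat.cast_id] at h1
  rw [← h1]
  refine Finset.sum_congr rfl fun β _ => Finset.prod_congr rfl fun c _ => ?_
  exact he c c.2 (β c) (β c).2

lemma classOf_succ_of_mem {D : Finset ℕ} (k : ℕ) (p v : V) (h : #(children G p v) ∈ D) :
    classOf D G (k + 1) p v = some ⟨⟨#(children G p v), h⟩,
      ⟨(children G p v).val.map (classOf D G k v), by simp⟩⟩ :=
  dif_pos h

lemma classOf_succ_of_notMem {D : Finset ℕ} (k : ℕ) (p v : V) (h : #(children G p v) ∉ D) :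
    classOf D G (k + 1) p v = none :=
  dif_neg h

/-- A class of height `k` retains all that a pattern branch of height at most `k` can detect; this
makes `K` a function of the classes alone. -/
lemma card_branchMaps_eq_branchCount (hM : M.IsTree) (k : ℕ) {q w : W} (h : M.Adj q w)
    (hk : ∀ x, InBranch M q w x → M.dist w x ≤ k) {p v : V} (hpv : G.Adj p v) :
    #(branchMaps M G q w p v) =
      branchCount M (outDegrees M) k q w (classOf (outDegrees M) G k p v) := by
  induction k generalizing q w p v with
  | zero =>
    exact card_branchMaps_of_not_isInternal hM h (not_isInternal_of_dist_le_zero hM h hk) p v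
  | succ k ih =>
    by_cases hw : IsInternal M w
    · rw [card_branchMaps_eq_forestCount hM h hw hpv (classOf (outDegrees M) G k v)
        (branchCount M (outDegrees M) k w) fun c hc y hy =>
          ih (mem_children.mp hc).1 (fun x hx => dist_le_of_child hM h hk hc hx)
            (mem_children.mp hy).1]
      rw [branchCount, if_pos hw]
      by_cases hD : #(children G p v) ∈ outDegrees M
      · rw [classOf_succ_of_mem k p v hD]
        rfl
      -- The internal node `w` has out-degree in `D` and that of `v` is not in `D`: no bijection of
      -- the children exists, in agreement with the value 0 at `□`.
      · rw [classOf_succ_of_notMem k p v hD]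
        refine (forestCount_eq_zero _ _ _ ?_).trans rfl
        rw [Multiset.card_map, Finset.card_val]
        intro heq
        exact hD (heq ▸ card_children_mem_outDegrees h hw)
    · rw [card_branchMaps_of_not_isInternal hM h hw, branchCount, if_neg hw]

open Classical in
/-- The number of internal nodes in a branch. -/
noncomputable def internalCount (M : SimpleGraph W) (q w : W) : ℕ :=
  #{x | InBranch M q w x ∧ IsInternal M x}

lemma internalCount_eq (hM : M.IsTree) {q w : W} (h : M.Adj q w) (hw : IsInternal M w) :
    internalCount M q w = 1 + ∑ c ∈ children M q w, internalCount M w c := by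
  classical
  have hsplit : ({x | InBranch M q w x ∧ IsInternal M x} : Finset W) =
      insert w (univ.filter fun x => (InBranch M q w x ∧ x ≠ w) ∧ IsInternal M x) := by
    ext x
    simp only [Finset.mem_filter, Finset.mem_univ, true_and, Finset.mem_insert]
    constructor
    · rintro ⟨h1, h2⟩
      by_cases hxw : x = w
      · exact Or.inl hxw
      · exact Or.inr ⟨⟨h1, hxw⟩, h2⟩
    · rintro (rfl | h1)
      · exact ⟨inBranch_self h, hw⟩
      · exact ⟨h1.1.1, h1.2⟩
  have hcard : #(univ.filter fun x => (InBranch M q w x ∧ x ≠ w) ∧ IsInternal M x) =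
      ∑ c ∈ children M q w, internalCount M w c := by
    rw [Finset.card_eq_sum_card_fiberwise (f := fun x => toward M x w) (t := children M q w)
      fun x hx => (toward_mem_children_iff hM h).mpr (Finset.mem_filter.mp hx).2.1]
    refine Finset.sum_congr rfl fun c hc => ?_
    rw [internalCount, Finset.filter_filter]
    congr 1
    ext x
    simp only [Finset.mem_filter, Finset.mem_univ, true_and]
    have hwc := (mem_children.mp hc).1
    constructor
    · rintro ⟨⟨⟨h1, h2⟩, h3⟩, rfl⟩
      exact ⟨inBranch_toward hM h2.symm, h3⟩
    · rintro ⟨h1, h2⟩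
      exact ⟨⟨⟨h1.of_child hM h hc, h1.ne_left⟩, h2⟩, h1.toward_eq hM hwc⟩
  rw [internalCount, hsplit, Finset.card_insert_of_notMem (by simp), hcard, add_comm]

lemma internalCount_of_not_isInternal (hM : M.IsTree) {q w : W} (h : M.Adj q w)
    (hw : ¬ IsInternal M w) : internalCount M q w = 0 := by
  classical
  rw [internalCount, Finset.card_eq_zero, Finset.filter_eq_empty_iff]
  rintro x - ⟨hx, hint⟩
  have hxw : x ≠ w := by rintro rfl; exact hw hint
  have hc := mem_children.mp (hx.toward_mem_children hM hxw)
  exact hw (isInternal_iff.mpr ⟨_, q, hc.1, h.symm, hc.2⟩)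

lemma critWeight_forest (hM : M.IsTree) (k : ℕ) {q w : W} (h : M.Adj q w) (hw : IsInternal M w)
    (ih : ∀ c ∈ children M q w, ∑ i, critWeight (outDegrees M) k i *
      branchCount M (outDegrees M) k w c i = (1 / Real.exp 1) ^ internalCount M w c) :
    1 / Real.exp 1 * ∑ d ∈ outDegrees M, ∑ s : Sym (TreeClass (outDegrees M) k) d,
      wt (critWeight (outDegrees M) k) s *
        forestCount (children M q w) (branchCount M (outDegrees M) k w)
          (s : Multiset (TreeClass (outDegrees M) k)) =
      (1 / Real.exp 1) ^ internalCount M q w := by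
  rw [sum_wt_mul_forestCount _ _ _ _ (card_children_mem_outDegrees h hw),
    Finset.prod_congr rfl ih, Finset.prod_pow_eq_pow_sum, internalCount_eq hM h hw, pow_add,
    pow_one]

/-- This is the expected number of maps of the branch to a Galton-Watson tree with Poisson(1)
offspring. Each internal node contributes the factor `1/e` (`critWeight_forest`), and external nodes
contribute the total mass 1. -/
lemma sum_critWeight_mul_branchCount (hM : M.IsTree) (k : ℕ) {q w : W} (h : M.Adj q w)
    (hk : ∀ x, InBranch M q w x → M.dist w x ≤ k) :
    ∑ i, critWeight (outDegrees M) k i * branchCount M (outDegrees M) k q w i =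
      (1 / Real.exp 1) ^ internalCount M q w := by
  induction k generalizing q w with
  | zero =>
    rw [internalCount_of_not_isInternal hM h (not_isInternal_of_dist_le_zero hM h hk)]
    simp [branchCount, critWeight]
  | succ k ih =>
    by_cases hw : IsInternal M w
    · have key := critWeight_forest hM k h hw fun c hc =>
        ih (mem_children.mp hc).1 fun x hx => dist_le_of_child hM h hk hc hx
      rw [← key, sum_treeClass_succ]
      simp only [branchCount, if_pos hw]
      rw [show Option.elim (α := Branching (outDegrees M) k) none 0 _ = 0 from rfl, Nat.cast_zero,
        mul_zero, zero_add, Fintype.sum_sigma, ← Finset.sum_coe_sort (outDegrees M),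
        Finset.mul_sum]
      refine Finset.sum_congr rfl fun d _ => ?_
      rw [Finset.mul_sum]
      refine Finset.sum_congr rfl fun s _ => ?_
      rw [← mul_assoc]
      rfl
    · rw [internalCount_of_not_isInternal hM h hw, pow_zero]
      simp only [branchCount, if_neg hw, Nat.cast_one, mul_one]
      exact sum_critWeight _ _

end Counts

/-! ### Occurrences as embeddings up to automorphisms -/

section Automorphisms

variable {V W : Type*} [Fintype V] [Fintype W] {M : SimpleGraph W} {G : SimpleGraph V}

lemma exists_iso_of_range_eq (f g : M ↪g G) (h : Set.range f = Set.range g) :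
    ∃ σ : M ≃g M, σ.toEmbedding.trans f = g := by
  have hex : ∀ x, ∃ y, f y = g x := fun x => by
    have : g x ∈ Set.range f := h ▸ ⟨x, rfl⟩
    exact this
  choose σ hσ using hex
  have hinj : Function.Injective σ := fun x y hxy => g.injective (by rw [← hσ, ← hσ, hxy])
  refine ⟨⟨Equiv.ofBijective σ (Finite.injective_iff_bijective.mp hinj), fun {a b} => ?_⟩, ?_⟩
  · rw [← f.map_adj_iff, ← g.map_adj_iff]
    simp only [Equiv.ofBijective_apply, hσ]
  · ext x
    exact hσ x

/-- Counting embeddings up to automorphisms of the pattern is counting their ranges. -/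
lemma card_embeddings_eq (Q : (M ↪g G) → Prop)
    (hQ : ∀ f (σ : M ≃g M), Q f → Q (σ.toEmbedding.trans f)) :
    Nat.card {f // Q f} =
      Nat.card (M ≃g M) * {S : Set V | ∃ f : M ↪g G, Q f ∧ Set.range f = S}.ncard := by
  rw [← Nat.card_coe_set_eq, ← Nat.card_prod]
  symm
  have hrange : ∀ (f : M ↪g G) (σ : M ≃g M), Set.range (σ.toEmbedding.trans f) = Set.range f := by
    intro f σ
    ext y
    constructor
    · rintro ⟨x, rfl⟩
      exact ⟨σ x, rfl⟩
    · rintro ⟨x, rfl⟩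
      exact ⟨σ.symm x, congrArg f (σ.apply_symm_apply x)⟩
  -- Choose one embedding for every range; any other with the same range differs from it by a unique
  -- automorphism.
  refine Nat.card_congr (Equiv.ofBijective
    (fun s => ⟨s.1.toEmbedding.trans s.2.2.choose, hQ _ _ s.2.2.choose_spec.1⟩) ⟨?_, ?_⟩)
  · rintro ⟨σ, S⟩ ⟨σ', S'⟩ h
    have h := congrArg Subtype.val h
    simp only at h
    have hS : S = S' := by
      apply Subtype.ext
      rw [← S.2.choose_spec.2, ← S'.2.choose_spec.2, ← hrange S.2.choose σ,
        ← hrange S'.2.choose σ', h]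
    subst hS
    have hσ : σ = σ' := by
      ext x
      exact S.2.choose.injective (DFunLike.congr_fun h x)
    rw [hσ]
  · rintro ⟨f, hf⟩
    let S : {S : Set V | ∃ f : M ↪g G, Q f ∧ Set.range f = S} := ⟨Set.range f, f, hf, rfl⟩
    obtain ⟨σ, hσ⟩ := exists_iso_of_range_eq S.2.choose f S.2.choose_spec.2
    exact ⟨⟨σ, S⟩, Subtype.ext hσ⟩

lemma isInternal_map_iso {w : W} (σ : M ≃g M) (hw : IsInternal M w) : IsInternal M (σ w) := by
  obtain ⟨a, b, ha, hb, hab⟩ := isInternal_iff.mp hw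
  exact isInternal_iff.mpr
    ⟨σ a, σ b, σ.map_adj_iff.mpr ha, σ.map_adj_iff.mpr hb, σ.injective.ne hab⟩

lemma IsMatch.trans_iso {f : M ↪g G} (hf : IsMatch M G f) (σ : M ≃g M) :
    IsMatch M G (σ.toEmbedding.trans f) := by
  rw [isMatch_iff_localIso] at *
  intro w hw
  refine (hf (σ w) (isInternal_map_iso σ hw)).comp (t := M.neighborSet (σ w))
    ⟨fun x hx => σ.map_adj_iff.mpr hx, σ.injective.injOn, fun y hy => ⟨σ.symm y, ?_, ?_⟩⟩
  · rw [SimpleGraph.mem_neighborSet] at *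
    rw [← σ.map_adj_iff, σ.apply_symm_apply]
    exact hy
  · exact σ.apply_symm_apply y

lemma card_isMatch_eq (hM : M.IsTree) (hG : G.IsTree) (hW : 3 ≤ Fintype.card W)
    (Q : (W → V) → Prop) :
    Nat.card {f : M ↪g G // IsMatch M G f ∧ Q f} =
      Nat.card {f : W → V // LocalIso M G f ∧ Q f} :=
  Nat.card_congr
    { toFun := fun f => ⟨f.1, (isMatch_iff_localIso _).mp f.2.1, f.2.2⟩
      invFun := fun f => ⟨f.2.1.toEmbedding hM hG hW,
        (isMatch_iff_localIso _).mpr f.2.1, f.2.2⟩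
      left_inv := fun _ => rfl
      right_inv := fun _ => rfl }

lemma card_aut_mul_occ (hM : M.IsTree) (hG : G.IsTree) (hW : 3 ≤ Fintype.card W) :
    Nat.card (M ≃g M) * occ M G = Nat.card {f : W → V // LocalIso M G f} := by
  rw [occ, ← card_embeddings_eq _ fun f σ hf => hf.trans_iso σ]
  simpa using card_isMatch_eq hM hG hW fun _ => True

lemma card_aut_mul_occAt (hM : M.IsTree) (hG : G.IsTree) (hW : 3 ≤ Fintype.card W) (r : V) :
    Nat.card (M ≃g M) * occAt M G r =
      Nat.card {f : W → V // LocalIso M G f ∧ ∃ w, IsInternal M w ∧ f w = r} := by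
  rw [← card_isMatch_eq hM hG hW fun f => ∃ w, IsInternal M w ∧ f w = r,
    card_embeddings_eq fun f => IsMatch M G f ∧ ∃ w, IsInternal M w ∧ f w = r, occAt]
  · simp only [and_comm, and_left_comm]
  · rintro f σ ⟨hf, w, hw, rfl⟩
    refine ⟨hf.trans_iso σ, σ.symm w, isInternal_map_iso σ.symm hw, ?_⟩
    exact congrArg f (σ.apply_symm_apply w)

end Automorphisms

/-! ### Occurrences at the root of a planted tree -/

section Planted

variable {V W : Type*} [Fintype V] [Fintype W] (M : SimpleGraph W) {G : SimpleGraph V}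

open Classical in
/-- The external nodes of a pattern. -/
noncomputable def leaves : Finset W := {q | ¬ IsInternal M q}

open Classical in
/-- The internal nodes of a pattern. -/
noncomputable def internals : Finset W := {q | IsInternal M q}

variable {M}

lemma exists_adj (hM : M.IsTree) (hW : 3 ≤ Fintype.card W) (q : W) : ∃ w, M.Adj q w := by
  have : Nontrivial W := Fintype.one_lt_card_iff_nontrivial.mp (by omega)
  obtain ⟨x, hx⟩ := exists_ne q
  obtain ⟨u, hu, -⟩ := exists_closer hM.connected hx.symm
  exact ⟨u, hu⟩

open Classical in
/-- A neighbor of a node. -/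
noncomputable def stem (M : SimpleGraph W) (q : W) : W :=
  if h : ∃ w, M.Adj q w then h.choose else q

lemma adj_stem (hM : M.IsTree) (hW : 3 ≤ Fintype.card W) (q : W) : M.Adj q (stem M q) := by
  have h := exists_adj hM hW q
  rw [stem, dif_pos h]
  exact h.choose_spec

lemma isInternal_stem (hM : M.IsTree) (hW : 3 ≤ Fintype.card W) {q : W} (hq : q ∈ leaves M) :
    IsInternal M (stem M q) := by
  rcases isInternal_or_of_adj hM hW (adj_stem hM hW q) with h | h
  · exact absurd h (by simpa [leaves] using hq)
  · exact h

lemma inBranch_stem_iff (hM : M.IsTree) (hW : 3 ≤ Fintype.card W) {q : W} (hq : q ∈ leaves M)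
    {x : W} : InBranch M q (stem M q) x ↔ x ≠ q := by
  refine ⟨fun h => h.ne_left, fun h => ?_⟩
  have h1 := inBranch_toward hM h.symm
  rwa [eq_of_not_isInternal (by simpa [leaves] using hq) (toward_spec hM.connected h.symm).1
    (adj_stem hM hW q)] at h1

lemma internalCount_stem (hM : M.IsTree) (hW : 3 ≤ Fintype.card W) {q : W} (hq : q ∈ leaves M) :
    internalCount M q (stem M q) = #(internals M) := by
  classical
  rw [internalCount, internals]
  congr 1
  ext x
  simp only [Finset.mem_filter, Finset.mem_univ, true_and, inBranch_stem_iff hM hW hq,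
    and_iff_right_iff_imp]
  rintro hx rfl
  exact absurd hx (by simpa [leaves] using hq)

/-- The branch that starts at an external node `q` contains every other node, and `r` is forced as
the image of the stem because it is the only neighbor of `p`. -/
lemma mem_branchMaps_stem (hM : M.IsTree) (hW : 3 ≤ Fintype.card W) {q : W} (hq : q ∈ leaves M)
    {p r : V} (hp : G.neighborSet p = {r}) {f : W → V} :
    f ∈ branchMaps M G q (stem M q) p r ↔ LocalIso M G f ∧ f q = p := by
  have hq' : ¬ IsInternal M q := by simpa [leaves] using hq
  simp only [mem_branchMaps, inBranch_stem_iff hM hW hq, not_not, forall_eq]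
  constructor
  · rintro ⟨h1, h2, h3⟩
    refine ⟨fun w hw => h3 w (fun h => hq' (h ▸ hw)) hw, h1⟩
  · rintro ⟨h1, h2⟩
    refine ⟨h2, ?_, fun x _ hx => h1 x hx⟩
    have h3 : f (stem M q) ∈ G.neighborSet p := h2 ▸ h1.adj hM hW (adj_stem hM hW q)
    rw [hp] at h3
    exact h3

/-- The phantom node is a neighbor of `r`, so it is the image of a neighbor `q` of the internal node
at `r`. Having degree one, it cannot be the image of an internal node, so `q` is external; by
injectivity `q` is unique. -/
lemma card_localIso_at_root (hM : M.IsTree) (hW : 3 ≤ Fintype.card W) {p r : V}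
    (hG : IsPlantedTree G p r) :
    Nat.card {f : W → V // LocalIso M G f ∧ ∃ w, IsInternal M w ∧ f w = r} =
      ∑ q ∈ leaves M, #(branchMaps M G q (stem M q) p r) := by
  classical
  obtain ⟨hT, hp⟩ := hG
  have hpr : G.Adj p r := by
    rw [← SimpleGraph.mem_neighborSet, hp]
    rfl
  rw [← Finset.card_biUnion, Nat.card_eq_fintype_card, Fintype.card_subtype]
  · congr 1
    ext f
    simp only [Finset.mem_filter, Finset.mem_univ, true_and, Finset.mem_biUnion]
    constructor
    · rintro ⟨hf, w, hw, rfl⟩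
      obtain ⟨q, hq, rfl⟩ := (hf w hw).surjOn hpr.symm
      have hql : q ∈ leaves M := by
        simp only [leaves, Finset.mem_filter, Finset.mem_univ, true_and]
        intro hint
        obtain ⟨a, b, ha, hb, hab⟩ := isInternal_iff.mp hint
        refine hab ((hf q hint).injOn ha hb ?_)
        have h1 : f a ∈ G.neighborSet (f q) := hf.adj hM hW ha
        have h2 : f b ∈ G.neighborSet (f q) := hf.adj hM hW hb
        rw [hp] at h1 h2
        exact h1.trans h2.symm
      exact ⟨q, hql, (mem_branchMaps_stem hM hW hql hp).mpr ⟨hf, rfl⟩⟩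
    · rintro ⟨q, hq, hf⟩
      exact ⟨((mem_branchMaps_stem hM hW hq hp).mp hf).1, stem M q, isInternal_stem hM hW hq,
        (mem_branchMaps.mp hf).2.1⟩
  · intro q hq q' hq' hne
    refine Finset.disjoint_left.mpr fun f hf hf' => hne ?_
    obtain ⟨h1, h2⟩ := (mem_branchMaps_stem hM hW hq hp).mp hf
    obtain ⟨-, h3⟩ := (mem_branchMaps_stem hM hW hq' hp).mp hf'
    exact (h1.toEmbedding hM hT hW).injective (h2.trans h3.symm)

/-- The bound is generous by one: it has the form `k + 1` needed in `dist_le_of_child` with `k =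
subHeight M + 1`, the height of the classes. -/
lemma dist_stem_le (hM : M.IsTree) (hW : 3 ≤ Fintype.card W) {q : W} (hq : q ∈ leaves M)
    {x : W} (hx : InBranch M q (stem M q) x) : M.dist (stem M q) x ≤ subHeight M + 1 + 1 := by
  classical
  have h1 : M.dist (stem M q) x ≤ maxHeight M := by
    rw [maxHeight]
    refine le_trans ?_ (Finset.le_sup (b := (stem M q, q)) ?_)
    · exact Finset.le_sup (f := fun w => M.dist (stem M q) w) (b := x)
        (Finset.mem_erase.mpr ⟨hx.ne_left, Finset.mem_univ _⟩)
    · simp only [Finset.mem_filter, Finset.mem_univ, true_and]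
      exact ⟨isInternal_stem hM hW hq, by simpa [leaves] using hq, (adj_stem hM hW q).symm⟩
  rw [subHeight]
  omega

/-- The number of occurrences at the root of a planted tree, in terms of the classes of the
branches at the root. -/
lemma card_aut_mul_occAt_root (hM : M.IsTree) (hW : 3 ≤ Fintype.card W) {p r : V}
    (hG : IsPlantedTree G p r) :
    Nat.card (M ≃g M) * occAt M G r = ∑ q ∈ leaves M, forestCount (children M q (stem M q))
      (branchCount M (outDegrees M) (subHeight M + 1) (stem M q))
      ((children G p r).val.map (classOf (outDegrees M) G (subHeight M + 1) r)) := by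
  rw [card_aut_mul_occAt hM hG.1 hW, card_localIso_at_root hM hW hG]
  refine Finset.sum_congr rfl fun q hq => ?_
  have hpr : G.Adj p r := by
    rw [← SimpleGraph.mem_neighborSet, hG.2]
    rfl
  have h := adj_stem hM hW q
  refine card_branchMaps_eq_forestCount hM h (isInternal_stem hM hW hq) hpr _ _ fun c hc y hy => ?_
  exact card_branchMaps_eq_branchCount hM _ (mem_children.mp hc).1
    (fun x hx => dist_le_of_child hM h (fun z hz => dist_stem_le hM hW hq hz) hc hx)
    (mem_children.mp hy).1

end Planted

/-! ### Realizing every multiset of classes by a planted tree -/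

section Realization

lemma IsParent.apply_apply_ne {V : Type*} {g : V → V} {r v : V} (hg : IsParent g r) (hv : v ≠ r) :
    g (g v) ≠ v := by
  intro h
  have hr : g v ≠ r := fun h' => hv (by rw [← h, h', hg.1])
  obtain ⟨a, ha, hga⟩ := hg.2 {v, g v} ⟨v, by simp⟩ (by
    simp only [Set.mem_insert_iff, Set.mem_singleton_iff, not_or]
    exact ⟨hv.symm, hr.symm⟩)
  simp only [Set.mem_insert_iff, Set.mem_singleton_iff, not_or] at ha hga
  rcases ha with rfl | rfl
  · exact hga.2 rfl
  · exact hga.1 h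

/-- This also covers the root, which is its own parent: erasing it from its own neighbors removes
nothing. -/
lemma IsParent.mem_children_iff {V : Type*} [Fintype V] {g : V → V} {r : V} (hg : IsParent g r)
    {u v : V} : u ∈ children (parentGraph g) (g v) v ↔ u ≠ v ∧ g u = v := by
  rw [mem_children]
  constructor
  · rintro ⟨⟨h1, h2 | h2⟩, h3⟩
    · exact absurd h2.symm h3
    · exact ⟨h1.symm, h2⟩
  · rintro ⟨h1, h2⟩
    refine ⟨⟨h1.symm, Or.inr h2⟩, fun h3 => ?_⟩
    by_cases hv : v = r
    · subst hv
      exact h1 (h3.trans hg.1)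
    · exact hg.apply_apply_ne hv (by rw [← h3, h2])

variable {ι : Type} [Fintype ι] {V : ι → Type} [∀ i, Fintype (V i)]

open Classical in
/-- The parent function of the tree whose branches at the root are given. -/
noncomputable def joinParent (g : ∀ i, V i → V i) (r : ∀ i, V i) :
    Option (Σ i, V i) → Option (Σ i, V i)
  | none => none
  | some x => if x.2 = r x.1 then none else some ⟨x.1, g x.1 x.2⟩

/-- The embedding of a branch in the joined tree. -/
def branchEmb (i : ι) : V i ↪ Option (Σ i, V i) :=
  ⟨fun u => some ⟨i, u⟩, (Option.some_injective _).comp sigma_mk_injective⟩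

/-- The embedding of the roots of the branches in the joined tree. -/
def rootEmb (r : ∀ i, V i) : ι ↪ Option (Σ i, V i) :=
  ⟨fun i => some ⟨i, r i⟩, fun _ _ h => congrArg Sigma.fst (Option.some.inj h)⟩

variable {g : ∀ i, V i → V i} {r : ∀ i, V i}

lemma branchEmb_apply (i : ι) (u : V i) : branchEmb i u = some ⟨i, u⟩ := rfl

lemma rootEmb_apply (i : ι) : rootEmb r i = some ⟨i, r i⟩ := rfl

lemma joinParent_some_of_ne {i : ι} {v : V i} (h : v ≠ r i) :
    joinParent g r (some ⟨i, v⟩) = some ⟨i, g i v⟩ := if_neg h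

lemma joinParent_some_root (i : ι) : joinParent g r (some ⟨i, r i⟩) = none := if_pos rfl

lemma isParent_joinParent (hg : ∀ i, IsParent (g i) (r i)) : IsParent (joinParent g r) none := by
  refine ⟨rfl, fun S hS hnone => ?_⟩
  obtain ⟨x, hx⟩ := hS
  obtain ⟨⟨i, v⟩, rfl⟩ := Option.ne_none_iff_exists'.mp fun h => hnone (h ▸ hx)
  by_cases hr : some ⟨i, r i⟩ ∈ S
  · exact ⟨_, hr, by rwa [joinParent_some_root]⟩
  · let T : Set (V i) := {u | (some ⟨i, u⟩ : Option (Σ i, V i)) ∈ S}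
    obtain ⟨a, ha, hga⟩ := (hg i).2 T ⟨v, hx⟩ hr
    refine ⟨some ⟨i, a⟩, ha, ?_⟩
    rw [joinParent_some_of_ne]
    · exact hga
    · rintro rfl
      exact hr ha

lemma children_joinParent_some (hg : ∀ i, IsParent (g i) (r i)) (i : ι) (v : V i) :
    children (parentGraph (joinParent g r)) (joinParent g r (some ⟨i, v⟩)) (some ⟨i, v⟩) =
      (children (parentGraph (g i)) (g i v) v).map
        (branchEmb i) := by
  ext x
  rw [(isParent_joinParent hg).mem_children_iff, Finset.mem_map]
  simp only [(hg i).mem_children_iff, branchEmb_apply]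
  constructor
  · rintro ⟨h1, h2⟩
    cases x with
    | none => exact absurd h2.symm (Option.some_ne_none _)
    | some x =>
      obtain ⟨j, u⟩ := x
      by_cases hu : u = r j
      · subst hu
        rw [joinParent_some_root] at h2
        exact absurd h2.symm (Option.some_ne_none _)
      · rw [joinParent_some_of_ne hu] at h2
        simp only [Option.some.injEq, Sigma.mk.injEq] at h2
        obtain ⟨rfl, h2⟩ := h2
        refine ⟨u, ⟨fun h => h1 (by rw [h]), by simpa using h2⟩, rfl⟩
  · rintro ⟨u, ⟨h1, h2⟩, rfl⟩
    refine ⟨fun h => h1 (by simpa using h), ?_⟩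
    rw [joinParent_some_of_ne, h2]
    rintro rfl
    exact h1 ((hg i).1.symm.trans h2)

lemma children_joinParent_none (hg : ∀ i, IsParent (g i) (r i)) :
    children (parentGraph (joinParent g r)) none none =
      (univ : Finset ι).map (rootEmb r) := by
  ext x
  rw [show children (parentGraph (joinParent g r)) none none =
    children (parentGraph (joinParent g r)) (joinParent g r none) none from rfl,
    (isParent_joinParent hg).mem_children_iff, Finset.mem_map]
  simp only [rootEmb_apply, Finset.mem_univ, true_and]
  constructor
  · rintro ⟨h1, h2⟩
    obtain ⟨⟨j, u⟩, rfl⟩ := Option.ne_none_iff_exists'.mp h1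
    by_cases hu : u = r j
    · exact ⟨j, by rw [hu]⟩
    · rw [joinParent_some_of_ne hu] at h2
      exact absurd h2 (Option.some_ne_none _)
  · rintro ⟨i, rfl⟩
    exact ⟨Option.some_ne_none _, joinParent_some_root i⟩

variable (D : Finset ℕ)

lemma classOf_eq_some {V' : Type*} [Fintype V'] {G : SimpleGraph V'} {k : ℕ} (p v : V')
    (m : Multiset (TreeClass D k)) (hm : (children G p v).val.map (classOf D G k v) = m)
    {d : ℕ} (hd : d ∈ D) (hcard : m.card = d) :
    classOf D G (k + 1) p v = some ⟨⟨d, hd⟩, ⟨m, hcard⟩⟩ := by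
  subst hm
  obtain rfl : #(children G p v) = d := by simpa using hcard
  exact classOf_succ_of_mem k p v hd

lemma classOf_congr {V' : Type*} [Fintype V'] {G : SimpleGraph V'} {k : ℕ} {p v : V'}
    {V'' : Type*} [Fintype V''] {H : SimpleGraph V''} {p' v' : V''}
    (h : (children G p v).val.map (classOf D G k v) =
      (children H p' v').val.map (classOf D H k v')) :
    classOf D G (k + 1) p v = classOf D H (k + 1) p' v' := by
  have hcard : #(children G p v) = #(children H p' v') := by
    simpa using congrArg Multiset.card h
  by_cases hD : #(children H p' v') ∈ D
  · rw [classOf_eq_some D p v _ h hD (by simp), classOf_eq_some D p' v' _ rfl hD (by simp)]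
  · rw [classOf_succ_of_notMem k p v (hcard ▸ hD), classOf_succ_of_notMem k p' v' hD]

lemma classOf_joinParent (hg : ∀ i, IsParent (g i) (r i)) (k : ℕ) (i : ι) (v : V i) :
    classOf D (parentGraph (joinParent g r)) k (joinParent g r (some ⟨i, v⟩)) (some ⟨i, v⟩) =
      classOf D (parentGraph (g i)) k (g i v) v := by
  induction k generalizing v with
  | zero => rfl
  | succ k ih =>
    refine classOf_congr D ?_
    rw [children_joinParent_some hg, Finset.map_val, Multiset.map_map]
    refine Multiset.map_congr rfl fun u hu => ?_
    obtain ⟨h1, h2⟩ := (hg i).mem_children_iff.mp hu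
    have h3 := ih u
    rw [joinParent_some_of_ne, h2] at h3
    · exact h3
    · rintro rfl
      exact h1 ((hg i).1.symm.trans h2)

lemma map_classOf_joinParent_none (hg : ∀ i, IsParent (g i) (r i)) (k : ℕ) :
    (children (parentGraph (joinParent g r)) none none).val.map
      (classOf D (parentGraph (joinParent g r)) k none) =
      (univ : Finset ι).val.map fun i => classOf D (parentGraph (g i)) k (r i) (r i) := by
  rw [children_joinParent_none hg, Finset.map_val, Multiset.map_map]
  refine Multiset.map_congr rfl fun i _ => ?_
  have := classOf_joinParent D hg k i (r i)
  rw [joinParent_some_root, (hg i).1] at this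
  exact this

lemma exists_fin_map_eq {α : Type*} (s : Multiset α) :
    ∃ f : Fin s.card → α, (univ : Finset (Fin s.card)).val.map f = s := by
  obtain ⟨l, rfl⟩ := Quot.exists_rep s
  exact ⟨l.get, (Fin.univ_val_map l.get).trans (by simp)⟩

/-- Every class contains a tree. -/
lemma exists_classOf_eq (h0 : 0 ∉ D) (k : ℕ) (c : TreeClass D k) :
    ∃ (V : Type) (_ : Fintype V) (g : V → V) (r : V), IsParent g r ∧
      classOf D (parentGraph g) k r r = c := by
  have hunit : IsParent (id : Unit → Unit) () :=
    ⟨rfl, fun S ⟨x, hx⟩ h => absurd hx h⟩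
  induction k with
  | zero => exact ⟨Unit, inferInstance, id, (), hunit, rfl⟩
  | succ k ih =>
    cases c with
    | none =>
      -- A single node has out-degree 0, which is not in `D`, so its class is `□`.
      refine ⟨Unit, inferInstance, id, (), hunit, classOf_succ_of_notMem k () () ?_⟩
      rw [Finset.card_eq_zero.mpr]
      · exact h0
      · ext x
        simp [mem_children]
    | some j =>
      obtain ⟨⟨d, hd⟩, s, hs⟩ := j
      simp only at hs
      obtain ⟨f, hf⟩ := exists_fin_map_eq s
      choose V hV g r hg hc using fun i => ih (f i)
      have hmap := map_classOf_joinParent_none D hg k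
      simp only [hc] at hmap
      replace hmap := hmap.trans hf
      exact ⟨Option (Σ i, V i), inferInstance, joinParent g r, none, isParent_joinParent hg,
        classOf_eq_some D none none s hmap hd hs⟩

/-- Every multiset of classes is realized by the branches at the root of a planted tree. -/
lemma exists_isPlantedTree (h0 : 0 ∉ D) (k : ℕ) (m : Multiset (TreeClass D k)) :
    ∃ (V : Type) (_ : Fintype V) (G : SimpleGraph V) (p r : V), IsPlantedTree G p r ∧
      (children G p r).val.map (classOf D G k r) = m := by
  obtain ⟨f, hf⟩ := exists_fin_map_eq m
  choose V hV g r hg hc using fun i => exists_classOf_eq D h0 k (f i)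
  have hmap := map_classOf_joinParent_none D hg k
  simp only [hc] at hmap
  replace hmap := hmap.trans hf
  -- Joining this one tree below a further root adds the phantom node.
  let g' : Unit → Option (Σ i, V i) → Option (Σ i, V i) := fun _ => joinParent g r
  have hg' : ∀ i, IsParent (g' i) none := fun _ => isParent_joinParent hg
  let P := joinParent g' fun _ => none
  have hP : IsParent P none := isParent_joinParent hg'
  refine ⟨Option (Σ _ : Unit, Option (Σ i, V i)), inferInstance, parentGraph P, none,
    some ⟨(), none⟩, ⟨hP.isTree, ?_⟩, ?_⟩
  · have h1 := children_joinParent_none hg'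
    ext x
    have h2 : x ∈ children (parentGraph P) none none ↔ x = some ⟨(), none⟩ := by
      rw [h1]
      simp [rootEmb_apply]
    rw [SimpleGraph.mem_neighborSet, Set.mem_singleton_iff, ← h2, mem_children]
    exact ⟨fun h => ⟨h, h.ne.symm⟩, fun h => h.1⟩
  · have h1 := children_joinParent_some hg' () none
    rw [joinParent_some_root] at h1
    rw [h1, Finset.map_val, Multiset.map_map]
    refine Eq.trans (Multiset.map_congr rfl fun u hu => ?_) hmap
    obtain ⟨h2, h3⟩ := (hg' ()).mem_children_iff.mp hu
    have h4 := classOf_joinParent D hg' k () u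
    rw [joinParent_some_of_ne h2, h3] at h4
    exact h4

end Realization

/-! ### The number K, and the value of the sum of the u-derivatives -/

section AddOcc

variable {W : Type*} [Fintype W] {M : SimpleGraph W}

lemma zero_notMem_outDegrees : 0 ∉ outDegrees M := by
  classical
  rw [outDegrees, Finset.mem_image]
  rintro ⟨w, hw, h⟩
  have h1 : IsInternal M w := by simpa using hw
  rw [IsInternal, ← degree_eq_ncard] at h1
  omega

/-- Realizability of `m` makes the set in `addOcc` nonempty, so its infimum is the count in an
actual tree and not the default 0; `card_aut_mul_occAt_root` evaluates that count in terms of `m`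
alone. -/
lemma card_aut_mul_addOcc (hM : M.IsTree) (hW : 3 ≤ Fintype.card W) (m : Multiset (Cls M)) :
    Nat.card (M ≃g M) * addOcc M m = ∑ q ∈ leaves M, forestCount (children M q (stem M q))
      (branchCount M (outDegrees M) (subHeight M + 1) (stem M q)) m := by
  obtain ⟨V, hV, G, p, r, hG, hm⟩ :=
    exists_isPlantedTree (outDegrees M) zero_notMem_outDegrees (subHeight M + 1) m
  obtain ⟨V, hV, G, p, r, hG, hm, hK⟩ := Nat.sInf_mem (s := {K | ∃ (V : Type) (_ : Fintype V)
    (G : SimpleGraph V) (p r : V), IsPlantedTree G p r ∧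
    (children G p r).val.map (classOf (outDegrees M) G (subHeight M + 1) r) = m ∧
    occAt M G r = K}) ⟨_, V, hV, G, p, r, hG, hm, rfl⟩
  rw [addOcc, ← hK, card_aut_mul_occAt_root hM hW hG, hm]

/-- The mean constant in terms of the number of leaves, the number of internal nodes and the number
of automorphisms of the pattern. -/
lemma sum_evalAt_polyU_critWeight (hM : M.IsTree) (hW : 3 ≤ Fintype.card W) :
    1 / Real.exp 1 * ∑ j : PosCls M,
      evalAt M (critWeight (outDegrees M) (subHeight M + 1)) 1 (polyU M j) =
      #(leaves M) / Nat.card (M ≃g M) * (1 / Real.exp 1) ^ #(internals M) := by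
  have hA : (Nat.card (M ≃g M) : ℝ) ≠ 0 := by
    have : Nonempty (M ≃g M) := ⟨SimpleGraph.Iso.refl⟩
    have : Finite (M ≃g M) := Finite.of_injective (fun σ x => σ x) DFunLike.coe_injective
    exact_mod_cast Nat.card_pos.ne'
  rw [div_mul_eq_mul_div (#(leaves M) : ℝ), eq_div_iff hA, sum_evalAt_polyU]
  have h1 : ∀ q ∈ leaves M, 1 / Real.exp 1 * ∑ d ∈ outDegrees M, ∑ s : Sym (Cls M) d,
      wt (critWeight (outDegrees M) (subHeight M + 1)) s *
        forestCount (children M q (stem M q))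
          (branchCount M (outDegrees M) (subHeight M + 1) (stem M q)) (s : Multiset (Cls M)) =
      (1 / Real.exp 1) ^ #(internals M) := by
    intro q hq
    have h := adj_stem hM hW q
    rw [← internalCount_stem hM hW hq, ← critWeight_forest hM (subHeight M + 1) h
      (isInternal_stem hM hW hq) fun c hc =>
        sum_critWeight_mul_branchCount hM _ (mem_children.mp hc).1 fun x hx =>
          dist_le_of_child hM h (fun z hz => dist_stem_le hM hW hq hz) hc hx]
  rw [← nsmul_eq_mul, ← Finset.sum_const, ← Finset.sum_congr rfl h1, ← Finset.mul_sum,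
    Finset.sum_comm, mul_assoc, Finset.sum_mul]
  congr 1
  refine Finset.sum_congr rfl fun d _ => ?_
  rw [Finset.sum_comm, Finset.sum_mul]
  refine Finset.sum_congr rfl fun s _ => ?_
  rw [← Finset.mul_sum, mul_assoc]
  congr 1
  rw [mul_comm]
  exact_mod_cast card_aut_mul_addOcc hM hW _

end AddOcc

universe u v

/-! ### Counting rooted forests with given roots -/

section Forests

/-- Every set of nodes `a` contains one whose parent `g a` lies outside of the set. -/
def Acyclic {A : Type u} {R : Type v} (g : A → A ⊕ R) : Prop :=
  ∀ S : Set A, S.Nonempty → ∃ a ∈ S, ∀ b ∈ S, g a ≠ Sum.inl b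

/-- The number of rooted forests with set of roots `R` and set of further nodes `A`. -/
noncomputable def numForests (A : Type u) (R : Type v) : ℕ :=
  Nat.card {g : A → A ⊕ R // Acyclic g}

variable {A : Type u} {R : Type v}

open Classical in
/-- The forest given by the set `K` of nodes below the roots, the roots above them, and the forest
with set of roots `K`. -/
noncomputable def extendForest (K : Finset A) (ρ : K → R)
    (g : {a // a ∉ K} → {a // a ∉ K} ⊕ K) : A → A ⊕ R := fun a =>
  if h : a ∈ K then Sum.inr (ρ ⟨a, h⟩) else Sum.inl (Sum.elim Subtype.val Subtype.val (g ⟨a, h⟩))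

lemma extendForest_mem (K : Finset A) (ρ : K → R) (g : {a // a ∉ K} → {a // a ∉ K} ⊕ K) (a : K) :
    extendForest K ρ g a = Sum.inr (ρ a) := dif_pos a.2

lemma extendForest_notMem (K : Finset A) (ρ : K → R) (g : {a // a ∉ K} → {a // a ∉ K} ⊕ K)
    (a : {a // a ∉ K}) :
    extendForest K ρ g a = Sum.inl (Sum.elim Subtype.val Subtype.val (g a)) := dif_neg a.2

lemma acyclic_extendForest {K : Finset A} {ρ : K → R} {g : {a // a ∉ K} → {a // a ∉ K} ⊕ K}
    (hg : Acyclic g) : Acyclic (extendForest K ρ g) := by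
  intro S hS
  by_cases hK : ∃ a ∈ S, a ∈ K
  · obtain ⟨a, ha, haK⟩ := hK
    refine ⟨a, ha, fun b _ => ?_⟩
    rw [extendForest_mem K ρ g ⟨a, haK⟩]
    exact Sum.inr_ne_inl
  · push Not at hK
    obtain ⟨x, hx⟩ := hS
    let T : Set {a // a ∉ K} := {a | (a : A) ∈ S}
    obtain ⟨a, ha, hga⟩ := hg T ⟨⟨x, hK x hx⟩, hx⟩
    refine ⟨a, ha, fun b hb => ?_⟩
    rw [extendForest_notMem]
    intro h
    have h := Sum.inl.inj h
    rcases hc : g a with c | c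
    · rw [hc, Sum.elim_inl] at h
      subst h
      exact hga c hb hc
    · rw [hc, Sum.elim_inr] at h
      subst h
      exact hK _ hb c.2

lemma sum_elim_val_injective (K : Finset A) :
    Function.Injective (Sum.elim Subtype.val Subtype.val : {a // a ∉ K} ⊕ K → A) := by
  rintro (a | a) (b | b) h
  · exact congrArg Sum.inl (Subtype.ext h)
  · simp only [Sum.elim_inl, Sum.elim_inr] at h
    exact absurd (h ▸ b.2) a.2
  · simp only [Sum.elim_inl, Sum.elim_inr] at h
    exact absurd (h ▸ a.2) b.2
  · exact congrArg Sum.inr (Subtype.ext h)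

/-- A forest is cut at the set `K` of nodes attached directly to a root: these choose their roots
freely, and without the old roots a forest rooted at `K` remains. -/
lemma extendForest_bijective [Fintype A] : Function.Bijective
    (fun s : (Σ K : Finset A, (K → R) × {g : {a // a ∉ K} → {a // a ∉ K} ⊕ K // Acyclic g}) =>
      (⟨extendForest s.1 s.2.1 s.2.2.1, acyclic_extendForest s.2.2.2⟩ :
        {g : A → A ⊕ R // Acyclic g})) := by
  classical
  constructor
  · rintro ⟨K, ρ, g, hg⟩ ⟨K', ρ', g', hg'⟩ h
    have h : extendForest K ρ g = extendForest K' ρ' g' := congrArg Subtype.val h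
    have hmem : ∀ (K : Finset A) (ρ : K → R) (g : {a // a ∉ K} → {a // a ∉ K} ⊕ K) (a : A),
        a ∈ K ↔ (extendForest K ρ g a).isRight := by
      intro K ρ g a
      by_cases ha : a ∈ K
      · rw [extendForest_mem K ρ g ⟨a, ha⟩]
        simpa using ha
      · rw [extendForest_notMem K ρ g ⟨a, ha⟩]
        simpa using ha
    have hK : K = K' := by
      ext a
      rw [hmem K ρ g, hmem K' ρ' g', h]
    subst hK
    have hρ : ρ = ρ' := by
      funext a
      have := congrFun h a
      rw [extendForest_mem, extendForest_mem] at this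
      exact Sum.inr.inj this
    have hg : g = g' := by
      funext a
      have := congrFun h a
      rw [extendForest_notMem, extendForest_notMem] at this
      exact sum_elim_val_injective K (Sum.inl.inj this)
    subst hρ hg
    rfl
  · rintro ⟨f, hf⟩
    let K : Finset A := {a | (f a).isRight}
    have hK : ∀ a : K, (f a).isRight := fun a => (Finset.mem_filter.mp a.2).2
    have hK' : ∀ a : {a // a ∉ K}, (f a).isLeft := fun a => by
      have := a.2
      simpa [K] using this
    let ρ : K → R := fun a => (f a).getRight (hK a)
    let g : {a // a ∉ K} → {a // a ∉ K} ⊕ K := fun a =>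
      if h : (f a).getLeft (hK' a) ∈ K then Sum.inr ⟨_, h⟩ else Sum.inl ⟨_, h⟩
    have hgval : ∀ a, Sum.elim Subtype.val Subtype.val (g a) = (f a).getLeft (hK' a) := fun a => by
      by_cases h : (f a).getLeft (hK' a) ∈ K
      · simp only [g, dif_pos h, Sum.elim_inr]
      · simp only [g, dif_neg h, Sum.elim_inl]
    have hext : extendForest K ρ g = f := by
      funext a
      by_cases ha : a ∈ K
      · rw [extendForest_mem K ρ g ⟨a, ha⟩]
        exact Sum.inr_getRight _ _
      · rw [extendForest_notMem K ρ g ⟨a, ha⟩, hgval]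
        exact Sum.inl_getLeft _ _
    refine ⟨⟨K, ρ, g, fun S hS => ?_⟩, Subtype.ext hext⟩
    obtain ⟨_, ⟨a, ha, rfl⟩, hfa⟩ := hf (Subtype.val '' S) (hS.image _)
    refine ⟨a, ha, fun b hb hgb => hfa b ⟨b, hb, rfl⟩ ?_⟩
    rw [← hext, extendForest_notMem, hgb]
    rfl

lemma numForests_eq_sum [Fintype A] [Finite R] :
    numForests A R =
      ∑ K : Finset A, Nat.card R ^ #K * numForests {a // a ∉ K} K := by
  classical
  rw [numForests, ← Nat.card_congr (Equiv.ofBijective _ extendForest_bijective), Nat.card_sigma]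
  refine Finset.sum_congr rfl fun K _ => ?_
  rw [Nat.card_prod, Nat.card_fun, numForests]
  simp

lemma numForests_of_isEmpty_left [IsEmpty A] : numForests A R = 1 := by
  rw [numForests, Nat.card_eq_one_iff_unique]
  refine ⟨⟨fun a b => Subtype.ext (Subsingleton.elim _ _)⟩,
    ⟨⟨isEmptyElim, fun S ⟨x, _⟩ => isEmptyElim x⟩⟩⟩

lemma numForests_of_isEmpty_right [Nonempty A] [IsEmpty R] : numForests A R = 0 := by
  rw [numForests, Nat.card_eq_zero]
  refine Or.inl ⟨fun ⟨g, hg⟩ => ?_⟩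
  obtain ⟨a, -, ha⟩ := hg Set.univ Set.univ_nonempty
  rcases hb : g a with b | b
  · exact ha b trivial hb
  · exact isEmptyElim b

/-- Absorb the factor `k` by `(n + 1).choose k * k = (n + 1) * n.choose (k - 1)` and apply the
binomial theorem. -/
lemma sum_choose_mul (n r : ℕ) :
    ∑ k ∈ range (n + 1 + 1), (n + 1).choose k * (r ^ k * (k * (n + 1) ^ (n + 1 - k))) =
      (n + 1) * (r * (n + 1 + r) ^ n) := by
  rw [Finset.sum_range_succ']
  simp only [zero_mul, mul_zero, add_zero]
  rw [add_comm (n + 1) r, add_pow, Finset.mul_sum, Finset.mul_sum]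
  refine Finset.sum_congr rfl fun k _ => ?_
  have h := Nat.add_one_mul_choose_eq n k
  rw [Nat.add_sub_add_right]
  calc _ = ((n + 1).choose (k + 1) * (k + 1)) * (r ^ (k + 1) * (n + 1) ^ (n - k)) := by ring
    _ = _ := by rw [← h]; push_cast; ring

/-- The formula for the number of forests, provided that it holds for smaller forests. -/
lemma numForests_eq_of_smaller [Fintype A] [Finite R] [Nonempty A]
    (ih : ∀ K : Finset A, K.Nonempty → numForests {a // a ∉ K} K * Nat.card A =
      #K * Nat.card A ^ (Nat.card A - #K)) :
    numForests A R = Nat.card R * (Nat.card A + Nat.card R) ^ (Nat.card A - 1) := by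
  obtain ⟨n, hn⟩ : ∃ n, Nat.card A = n + 1 := ⟨_, (Nat.succ_pred_eq_of_pos Nat.card_pos).symm⟩
  have hA : #(univ : Finset A) = n + 1 := by rw [Finset.card_univ, ← Nat.card_eq_fintype_card, hn]
  simp only [hn] at ih ⊢
  have key : numForests A R * (n + 1) = (n + 1) * (Nat.card R * (n + 1 + Nat.card R) ^ n) := by
    have h1 := Finset.sum_powerset_apply_card (α := ℕ) (x := (univ : Finset A))
      fun k => Nat.card R ^ k * (k * (n + 1) ^ (n + 1 - k))
    simp only [smul_eq_mul, hA, Finset.powerset_univ] at h1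
    rw [← sum_choose_mul, ← h1, numForests_eq_sum, Finset.sum_mul]
    refine Finset.sum_congr rfl fun K _ => ?_
    rw [mul_assoc]
    congr 1
    rcases K.eq_empty_or_nonempty with rfl | hK
    · have : Nonempty {a : A // a ∉ (∅ : Finset A)} := ⟨⟨Classical.arbitrary A, by simp⟩⟩
      rw [numForests_of_isEmpty_right]
      simp
    · exact ih K hK
  rw [Nat.add_sub_cancel]
  exact Nat.eq_of_mul_eq_mul_left n.succ_pos (by rw [← key, mul_comm])

/-- Multiplying by the number of all nodes avoids the exponent `Nat.card A - 1`, so that the formula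
includes empty `A`, which occurs in the recursion for `K = univ`. The types share a universe because
nodes become roots in the recursion. -/
lemma numForests_mul_aux (n : ℕ) (A R : Type u) [Finite A] [Finite R] (hn : Nat.card A = n) :
    numForests A R * (Nat.card A + Nat.card R) =
      Nat.card R * (Nat.card A + Nat.card R) ^ Nat.card A := by
  classical
  induction n using Nat.strong_induction_on generalizing A R with
  | _ n ih =>
    have := Fintype.ofFinite A
    rcases isEmpty_or_nonempty A with hA | hA
    · rw [numForests_of_isEmpty_left]
      simp
    · have hpos : 0 < Nat.card A := Nat.card_pos
      rw [numForests_eq_of_smaller, mul_assoc, ← pow_succ, Nat.sub_add_cancel hpos]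
      intro K hK
      have h1 : Nat.card {a // a ∉ K} + Nat.card K = Nat.card A := by
        rw [Nat.card_eq_fintype_card, Nat.card_eq_fintype_card, Nat.card_eq_fintype_card,
          Fintype.card_subtype_compl, Fintype.card_coe]
        have := Finset.card_le_univ K
        omega
      have h2 : Nat.card K = #K := by simp
      have h3 := hK.card_pos
      have := ih _ (by omega) {a // a ∉ K} K rfl
      rw [h1, h2] at this
      rw [this]
      congr 2
      omega

lemma numForests_eq [Finite A] [Finite R] [Nonempty A] :
    numForests A R = Nat.card R * (Nat.card A + Nat.card R) ^ (Nat.card A - 1) := by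
  classical
  have := Fintype.ofFinite A
  refine numForests_eq_of_smaller fun K hK => ?_
  have h1 : Nat.card {a // a ∉ K} + Nat.card K = Nat.card A := by
    rw [Nat.card_eq_fintype_card, Nat.card_eq_fintype_card, Nat.card_eq_fintype_card,
      Fintype.card_subtype_compl, Fintype.card_coe]
    have := Finset.card_le_univ K
    omega
  have h2 : Nat.card K = #K := by simp
  have := numForests_mul_aux _ {a // a ∉ K} K rfl
  rw [h1, h2] at this
  rw [this]
  congr 2
  omega

end Forests

/-! ### Extending a parent function from the image of the pattern -/

section ParentFunctions

variable {V : Type u} {W : Type v} [Finite V] {f : W → V} {par : W → W} {w₀ : W} {P : W → Prop}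

open Classical in
/-- The parent function that is given on the range of `f`, and by a forest elsewhere. -/
noncomputable def attach (f : W → V) (par : W → W) (P : W → Prop)
    (g : {v // v ∉ Set.range f} → {v // v ∉ Set.range f} ⊕ {w // P w}) : V → V := fun v =>
  if h : v ∈ Set.range f then f (par h.choose) else
    Sum.elim Subtype.val (fun w => f w.1) (g ⟨v, h⟩)

lemma attach_apply (hf : Function.Injective f)
    (g : {v // v ∉ Set.range f} → {v // v ∉ Set.range f} ⊕ {w // P w}) (w : W) :
    attach f par P g (f w) = f (par w) := by
  have h : f w ∈ Set.range f := ⟨w, rfl⟩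
  rw [attach, dif_pos h, hf h.choose_spec]

lemma attach_notMem (g : {v // v ∉ Set.range f} → {v // v ∉ Set.range f} ⊕ {w // P w})
    (v : {v // v ∉ Set.range f}) :
    attach f par P g v = Sum.elim Subtype.val (fun w => f w.1) (g v) := dif_neg v.2

lemma isParent_attach (hf : Function.Injective f) (hpar : IsParent par w₀)
    {g : {v // v ∉ Set.range f} → {v // v ∉ Set.range f} ⊕ {w // P w}} (hg : Acyclic g) :
    IsParent (attach f par P g) (f w₀) := by
  refine ⟨by rw [attach_apply hf, hpar.1], fun S hS hr => ?_⟩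
  by_cases hK : ∃ w, f w ∈ S
  · obtain ⟨w, hw⟩ := hK
    obtain ⟨a, ha, hpa⟩ := hpar.2 (f ⁻¹' S) ⟨w, hw⟩ hr
    exact ⟨f a, ha, by rwa [attach_apply hf]⟩
  · push Not at hK
    obtain ⟨x, hx⟩ := hS
    have hxr : x ∉ Set.range f := by
      rintro ⟨w, rfl⟩
      exact hK w hx
    obtain ⟨a, ha, hga⟩ := hg (Subtype.val ⁻¹' S) ⟨⟨x, hxr⟩, hx⟩
    refine ⟨a, ha, fun h => ?_⟩
    rw [attach_notMem] at h
    rcases hc : g a with c | c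
    · rw [hc] at h
      exact hga c h hc
    · rw [hc] at h
      exact hK _ h

/-- The number of parent functions that extend a given one. -/
lemma card_isParent_extending (hf : Function.Injective f) (hpar : IsParent par w₀) :
    Nat.card {g : V → V // IsParent g (f w₀) ∧ (∀ w, g (f w) = f (par w)) ∧
      ∀ v ∉ Set.range f, ∀ w, g v = f w → P w} =
      numForests {v // v ∉ Set.range f} {w // P w} := by
  classical
  symm
  refine Nat.card_congr (Equiv.ofBijective
    (fun g => ⟨attach f par P g.1, isParent_attach hf hpar g.2, attach_apply hf g.1,
      fun v hv w hw => ?_⟩) ⟨?_, ?_⟩)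
  · rw [attach_notMem g.1 ⟨v, hv⟩] at hw
    rcases hc : g.1 ⟨v, hv⟩ with c | c
    · rw [hc] at hw
      exact absurd ⟨w, hw.symm⟩ c.2
    · rw [hc] at hw
      exact hf hw ▸ c.2
  · rintro ⟨g, hg⟩ ⟨g', hg'⟩ h
    have h : attach f par P g = attach f par P g' := congrArg Subtype.val h
    refine Subtype.ext (funext fun v => ?_)
    have h1 := congrFun h v
    rw [attach_notMem, attach_notMem] at h1
    change g v = g' v
    rcases hc : g v with c | c <;> rcases hc' : g' v with c' | c' <;> rw [hc, hc'] at h1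
    · exact congrArg Sum.inl (Subtype.ext h1)
    · exact absurd ⟨_, h1.symm⟩ c.2
    · exact absurd ⟨_, h1⟩ c'.2
    · exact congrArg Sum.inr (Subtype.ext (hf h1))
  · rintro ⟨G, hG, hG1, hG2⟩
    let g : {v // v ∉ Set.range f} → {v // v ∉ Set.range f} ⊕ {w // P w} := fun v =>
      if h : G v ∈ Set.range f then
        Sum.inr ⟨h.choose, hG2 v v.2 _ h.choose_spec.symm⟩ else Sum.inl ⟨_, h⟩
    have hgval : ∀ v, Sum.elim Subtype.val (fun w => f w.1) (g v) = G v := fun v => by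
      by_cases h : G v ∈ Set.range f
      · simp only [g, dif_pos h, Sum.elim_inr]
        exact h.choose_spec
      · simp only [g, dif_neg h, Sum.elim_inl]
    refine ⟨⟨g, fun S hS => ?_⟩, Subtype.ext (funext fun v => ?_)⟩
    · obtain ⟨_, ⟨a, ha, rfl⟩, hGa⟩ := hG.2 (Subtype.val '' S) (hS.image _) (by
        rintro ⟨a, -, ha⟩
        exact a.2 ⟨w₀, ha.symm⟩)
      refine ⟨a, ha, fun b hb hgb => hGa ⟨b, hb, ?_⟩⟩
      rw [← hgval, hgb]
      rfl
    · by_cases hv : v ∈ Set.range f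
      · obtain ⟨w, rfl⟩ := hv
        exact (attach_apply hf g w).trans (hG1 w).symm
      · exact (attach_notMem g ⟨v, hv⟩).trans (hgval _)

end ParentFunctions

/-! ### Cayley's formula and the total number of occurrences -/

section TreeCounts

variable {V W : Type*} [Finite V] [Fintype W] {M : SimpleGraph W}

/-- With `M` rooted at `w₀` and `T` at `f w₀`, the parents inside the range are prescribed by `M`,
and nodes outside may hang on the pattern only at external nodes. This turns the count of trees into
a count of forests. -/
lemma localIso_iff_toward (hM : M.IsTree) (hW : 3 ≤ Fintype.card W) {T : SimpleGraph V}
    (hT : T.IsTree) {f : W → V} (hf : Function.Injective f) (w₀ : W) :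
    LocalIso M T f ↔ (∀ w, toward T (f w₀) (f w) = f (toward M w₀ w)) ∧
      ∀ v ∉ Set.range f, ∀ w, toward T (f w₀) v = f w → ¬ IsInternal M w := by
  constructor
  · intro h
    refine ⟨fun w => ?_, fun v hv w hvw hw => ?_⟩
    · by_cases hw : w = w₀
      · rw [hw, toward_self, toward_self]
      · obtain ⟨h1, h2⟩ := toward_spec hM.connected hw
        refine toward_eq hT (h.adj hM hW h1) ?_
        rw [h.dist_eq hM hT hW, h.dist_eq hM hT hW, h2]
    · have hv0 : v ≠ f w₀ := by
        rintro rfl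
        exact hv ⟨w₀, rfl⟩
      have h1 := (toward_spec hT.connected hv0).1
      rw [hvw] at h1
      obtain ⟨w', -, rfl⟩ := (h w hw).surjOn h1.symm
      exact hv ⟨w', rfl⟩
  · rintro ⟨h1, h2⟩ w hw
    have hadjM : ∀ x y, M.Adj x y ↔ x ≠ y ∧ (toward M w₀ x = y ∨ toward M w₀ y = x) :=
      fun x y => by
        conv_lhs => rw [← parentGraph_toward hM w₀]
        rfl
    have hadjT : ∀ x y, T.Adj x y ↔
        x ≠ y ∧ (toward T (f w₀) x = y ∨ toward T (f w₀) y = x) := fun x y => by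
      conv_lhs => rw [← parentGraph_toward hT (f w₀)]
      rfl
    refine ⟨fun x hx => ?_, hf.injOn, fun v hv => ?_⟩
    · rw [SimpleGraph.mem_neighborSet, hadjM] at hx
      rw [SimpleGraph.mem_neighborSet, hadjT, h1, h1]
      exact ⟨hf.ne hx.1, hx.2.imp (congrArg f) (congrArg f)⟩
    · rw [SimpleGraph.mem_neighborSet, hadjT] at hv
      obtain ⟨hne, hv | hv⟩ := hv
      · rw [h1] at hv
        subst hv
        refine ⟨_, ?_, rfl⟩
        rw [SimpleGraph.mem_neighborSet, hadjM]
        exact ⟨fun h => hne (congrArg f h), Or.inl rfl⟩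
      · by_cases hvr : v ∈ Set.range f
        · obtain ⟨w', rfl⟩ := hvr
          rw [h1] at hv
          refine ⟨w', ?_, rfl⟩
          rw [SimpleGraph.mem_neighborSet, hadjM]
          exact ⟨fun h => hne (congrArg f h), Or.inr (hf hv)⟩
        · exact absurd hw (h2 v hvr w hv)

/-- The number of trees in which a given injection is an occurrence. -/
lemma card_trees_localIso (hM : M.IsTree) (hW : 3 ≤ Fintype.card W) {f : W → V}
    (hf : Function.Injective f) (w₀ : W) :
    Nat.card {T : SimpleGraph V // T.IsTree ∧ LocalIso M T f} =
      numForests {v // v ∉ Set.range f} {w // ¬ IsInternal M w} := by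
  rw [← card_isParent_extending hf (isParent_toward hM.connected w₀)]
  refine Nat.card_congr
    { toFun := fun T => ⟨toward T.1 (f w₀), isParent_toward T.2.1.connected _,
        (localIso_iff_toward hM hW T.2.1 hf w₀).mp T.2.2⟩
      invFun := fun g => ⟨parentGraph g.1, g.2.1.isTree,
        (localIso_iff_toward hM hW g.2.1.isTree hf w₀).mpr ?_⟩
      left_inv := fun T => Subtype.ext (parentGraph_toward T.2.1 _)
      right_inv := fun g => Subtype.ext g.2.1.toward_parentGraph }
  rw [g.2.1.toward_parentGraph]
  exact g.2.2

lemma card_notMem_range {f : W → V} (hf : Function.Injective f) :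
    Nat.card {v // v ∉ Set.range f} = Nat.card V - Fintype.card W := by
  have h := Set.ncard_add_ncard_compl (Set.range f)
  rw [← Nat.card_coe_set_eq, Nat.card_range_of_injective hf, Nat.card_eq_fintype_card,
    ← Nat.card_coe_set_eq] at h
  change _ + Nat.card {v // v ∉ Set.range f} = _ at h
  omega

/-- **Cayley's formula** for the number of labeled trees. -/
lemma card_trees_eq (hV : 2 ≤ Nat.card V) :
    Nat.card {T : SimpleGraph V // T.IsTree} = Nat.card V ^ (Nat.card V - 2) := by
  have : Nonempty V := (Nat.card_pos_iff.mp (by omega)).1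
  obtain ⟨r⟩ := this
  -- A tree is viewed as a forest with the single root `r`, the image of a one-node tree at which
  -- everything may be attached.
  have hunit : IsParent (id : Unit → Unit) () :=
    ⟨rfl, fun S ⟨x, hx⟩ h => absurd hx h⟩
  have hinj : Function.Injective fun _ : Unit => r := fun _ _ _ => rfl
  have h := card_isParent_extending (P := fun _ => True) hinj hunit
  have h1 : Nat.card {T : SimpleGraph V // T.IsTree} = Nat.card {g : V → V // IsParent g r} :=
    Nat.card_congr
      { toFun := fun T => ⟨toward T.1 r, isParent_toward T.2.connected _⟩
        invFun := fun g => ⟨parentGraph g.1, g.2.isTree⟩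
        left_inv := fun T => Subtype.ext (parentGraph_toward T.2 _)
        right_inv := fun g => Subtype.ext g.2.toward_parentGraph }
  have h2 : Nat.card {g : V → V // IsParent g r} = Nat.card {g : V → V // IsParent g r ∧
      (∀ w : Unit, g r = r) ∧ ∀ v ∉ Set.range fun _ : Unit => r, ∀ w : Unit, g v = r → True} :=
    Nat.card_congr (Equiv.subtypeEquivRight fun g =>
      ⟨fun hg => ⟨hg, fun _ => hg.1, fun _ _ _ _ => trivial⟩, fun hg => hg.1⟩)
  rw [h1, h2]
  refine h.trans ?_
  have hA := card_notMem_range hinj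
  rw [Fintype.card_unit] at hA
  have : Nonempty {v // v ∉ Set.range fun _ : Unit => r} :=
    (Nat.card_pos_iff.mp (by rw [hA]; omega)).1
  have hR : Nat.card {w : Unit // True} = 1 := by
    rw [Nat.card_congr (Equiv.subtypeUnivEquiv fun _ => trivial), Nat.card_unique]
  rw [numForests_eq, hA, hR, one_mul, Nat.sub_add_cancel (by omega)]
  congr 1

lemma card_not_isInternal (M : SimpleGraph W) :
    Nat.card {w // ¬ IsInternal M w} = #(leaves M) := by
  classical
  rw [Nat.card_eq_fintype_card, Fintype.card_subtype, leaves]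

lemma card_internals_add_card_leaves (M : SimpleGraph W) :
    #(internals M) + #(leaves M) = Fintype.card W := by
  classical
  rw [internals, leaves, Finset.card_filter_add_card_filter_not, Finset.card_univ]

lemma card_trees_localIso_eq (hM : M.IsTree) (hW : 3 ≤ Fintype.card W)
    (hV : Fintype.card W < Nat.card V) {f : W → V} (hf : Function.Injective f) :
    Nat.card {T : SimpleGraph V // T.IsTree ∧ LocalIso M T f} =
      #(leaves M) * (Nat.card V - #(internals M)) ^ (Nat.card V - Fintype.card W - 1) := by
  obtain ⟨w₀⟩ := hM.connected.nonempty
  have hA := card_notMem_range hf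
  have : Nonempty {v // v ∉ Set.range f} := (Nat.card_pos_iff.mp (by rw [hA]; omega)).1
  rw [card_trees_localIso hM hW hf w₀, numForests_eq, hA, card_not_isInternal]
  have := card_internals_add_card_leaves M
  congr 2
  omega

lemma card_labeledTrees {n : ℕ} (hn : 2 ≤ n) : #(labeledTrees n) = n ^ (n - 2) := by
  classical
  have h := card_trees_eq (V := Fin n) (by simpa using hn)
  rw [Nat.card_eq_fintype_card, Fintype.card_subtype, Nat.card_fin] at h
  rw [← h, labeledTrees]

/-- The total number of occurrences in all the labeled trees of size `n`. -/
lemma card_aut_mul_sum_occ (hM : M.IsTree) (hW : 3 ≤ Fintype.card W) {n : ℕ}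
    (hn : Fintype.card W < n) :
    Nat.card (M ≃g M) * ∑ T ∈ labeledTrees n, occ M T =
      n.descFactorial (Fintype.card W) *
        (#(leaves M) * (n - #(internals M)) ^ (n - Fintype.card W - 1)) := by
  classical
  have hT : ∀ T ∈ labeledTrees n, T.IsTree := fun T hT => by
    rw [labeledTrees, Finset.mem_filter] at hT
    exact hT.2
  have h1 : ∀ T ∈ labeledTrees n, Nat.card (M ≃g M) * occ M T =
      #(Finset.bipartiteAbove (fun T (f : W → Fin n) => LocalIso M T f) univ T) := by
    intro T hTn
    rw [card_aut_mul_occ hM (hT T hTn) hW, Nat.card_eq_fintype_card, Fintype.card_subtype,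
      Finset.bipartiteAbove]
  -- Double counting of the pairs of a tree `T` and a map `f` that is a local isomorphism to `T`;
  -- only injective `f` contribute.
  rw [Finset.mul_sum, Finset.sum_congr rfl h1,
    Finset.sum_card_bipartiteAbove_eq_sum_card_bipartiteBelow]
  have h2 : ∀ f : W → Fin n,
      #(Finset.bipartiteBelow (fun T (f : W → Fin n) => LocalIso M T f) (labeledTrees n) f) =
      if Function.Injective f then
        #(leaves M) * (n - #(internals M)) ^ (n - Fintype.card W - 1) else 0 := by
    intro f
    split_ifs with hf
    · have h3 := card_trees_localIso_eq (V := Fin n) hM hW (by simpa using hn) hf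
      rw [Nat.card_fin, Nat.card_eq_fintype_card, Fintype.card_subtype] at h3
      rw [← h3, Finset.bipartiteBelow, labeledTrees, Finset.filter_filter]
    · rw [Finset.card_eq_zero, Finset.bipartiteBelow, Finset.filter_eq_empty_iff]
      intro T hTn hloc
      exact hf (hloc.toEmbedding hM (hT T hTn) hW).injective
  rw [Finset.sum_congr rfl fun f _ => h2 f, ← Finset.sum_filter, Finset.sum_const, smul_eq_mul]
  congr 1
  have h3 : Fintype.card (W ↪ Fin n) = #{f : W → Fin n | Function.Injective f} := by
    rw [← Fintype.card_subtype]
    exact Fintype.card_congr (Equiv.subtypeInjectiveEquivEmbedding W (Fin n)).symm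
  rw [← h3, Fintype.card_embedding_eq, Fintype.card_fin]

end TreeCounts

/-! ### The limit of the mean number of occurrences -/

section Asymptotics

open Filter Topology

/-- `(1 - i/n)^n` tends to `e^(-i)`, and the `w + 1` missing factors tend to 1. -/
lemma tendsto_one_sub_div_pow (i w : ℕ) :
    Tendsto (fun n : ℕ => (((n - i : ℕ) : ℝ) / n) ^ (n - w - 1)) atTop
      (𝓝 ((1 / Real.exp 1) ^ i)) := by
  have h1 : Tendsto (fun n : ℕ => 1 - (i : ℝ) / n) atTop (𝓝 1) := by
    simpa using (tendsto_const_div_atTop_nhds_zero_nat (i : ℝ)).const_sub 1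
  have h2 := Real.tendsto_one_add_div_pow_exp (-(i : ℝ))
  have h3 := h2.div (h1.pow (w + 1)) (by norm_num)
  have h4 : Real.exp (-(i : ℝ)) / 1 ^ (w + 1) = (1 / Real.exp 1) ^ i := by
    rw [one_pow, div_one, one_div, ← Real.exp_neg, ← Real.exp_nat_mul]
    ring_nf
  rw [h4] at h3
  refine h3.congr' ?_
  filter_upwards [eventually_gt_atTop (i + w + 1)] with n hn
  have hn0 : (n : ℝ) ≠ 0 := by
    have : n ≠ 0 := by omega
    exact_mod_cast this
  have hni : (n : ℝ) - i ≠ 0 := by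
    have : (i : ℝ) < n := by exact_mod_cast (by omega : i < n)
    exact (sub_pos.mpr this).ne'
  have e1 : ((n - i : ℕ) : ℝ) / n = 1 - (i : ℝ) / n := by
    rw [Nat.cast_sub (by omega)]
    field_simp
  have e2 : 1 + -(i : ℝ) / n = 1 - (i : ℝ) / n := by ring
  have e3 : 1 - (i : ℝ) / n ≠ 0 := by
    rw [← e1, Nat.cast_sub (by omega)]
    exact div_ne_zero hni hn0
  simp only [Pi.div_apply]
  rw [e1, e2, div_eq_iff (pow_ne_zero _ e3), ← pow_add]
  congr 1
  omega

lemma isMeanConstant {W : Type*} [Fintype W] {M : SimpleGraph W} (hM : M.IsTree)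
    (hW : 3 ≤ Fintype.card W) :
    IsMeanConstant M
      (#(leaves M) / Nat.card (M ≃g M) * (1 / Real.exp 1) ^ #(internals M)) := by
  classical
  have hA : (0 : ℝ) < Nat.card (M ≃g M) := by
    have : Nonempty (M ≃g M) := ⟨SimpleGraph.Iso.refl⟩
    have : Finite (M ≃g M) := Finite.of_injective (fun σ x => σ x) DFunLike.coe_injective
    exact_mod_cast Nat.card_pos
  have hl : 0 < #(leaves M) := by
    have : Nontrivial W := Fintype.one_lt_card_iff_nontrivial.mp (by omega)
    obtain ⟨v, hv⟩ := hM.exists_vert_degree_one_of_nontrivial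
    refine Finset.card_pos.mpr ⟨v, ?_⟩
    rw [leaves, Finset.mem_filter, IsInternal, ← degree_eq_ncard, hv]
    simp
  have hl' : (0 : ℝ) < #(leaves M) := by exact_mod_cast hl
  have hμ : 0 < #(leaves M) / Nat.card (M ≃g M) * (1 / Real.exp 1) ^ #(internals M) := by
    positivity
  refine ⟨hμ, ?_⟩
  set w := Fintype.card W
  set i := #(internals M)
  have hlim : Tendsto (fun n : ℕ => meanOcc M n / n) atTop
      (𝓝 (#(leaves M) / Nat.card (M ≃g M) * (1 / Real.exp 1) ^ i)) := by
    have h0 : ∀ᶠ n : ℕ in atTop, ((n : ℝ) ^ w) ≠ 0 := by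
      filter_upwards [eventually_gt_atTop 0] with n hn
      positivity
    have h1 := (Asymptotics.isEquivalent_iff_tendsto_one h0).mp (isEquivalent_descFactorial w)
    have h2 := (tendsto_one_sub_div_pow i w).const_mul
      ((#(leaves M) : ℝ) / Nat.card (M ≃g M))
    have h3 := h1.mul h2
    rw [one_mul] at h3
    refine h3.congr' ?_
    filter_upwards [eventually_gt_atTop (w + 2)] with n hn
    have hn0 : (n : ℝ) ≠ 0 := by
      have : n ≠ 0 := by omega
      exact_mod_cast this
    have hsum := card_aut_mul_sum_occ hM hW (n := n) (by omega)
    have hsum' : (Nat.card (M ≃g M) : ℝ) * ∑ T ∈ labeledTrees n, (occ M T : ℝ) =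
        (n.descFactorial w : ℝ) * (#(leaves M) * ((n - i : ℕ) : ℝ) ^ (n - w - 1)) := by
      exact_mod_cast hsum
    rw [mul_comm, ← eq_div_iff hA.ne'] at hsum'
    rw [meanOcc, hsum', card_labeledTrees (by omega)]
    simp only [Pi.div_apply, div_pow]
    -- With the extra `n` from `meanOcc M n / n`, the denominator `n^(n - 1)` splits into `n^w` for
    -- the falling factorial and `n^(n - w - 1)` for the power of `n - i`.
    have hsplit : n - 2 + 1 = w + (n - w - 1) := by omega
    push_cast
    rw [div_div _ ((n : ℝ) ^ (n - 2)), ← pow_succ, hsplit, pow_add]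
    field_simp
  have h0 : ∀ᶠ n : ℕ in atTop,
      #(leaves M) / Nat.card (M ≃g M) * (1 / Real.exp 1) ^ i * (n : ℝ) ≠ 0 := by
    filter_upwards [eventually_gt_atTop 0] with n hn
    positivity
  rw [Asymptotics.isEquivalent_iff_tendsto_one h0]
  have h1 := hlim.div_const (#(leaves M) / Nat.card (M ≃g M) * (1 / Real.exp 1) ^ i)
  rw [div_self hμ.ne'] at h1
  refine h1.congr fun n => ?_
  rw [Pi.div_apply, div_div, mul_comm (n : ℝ)]

end Asymptotics

end TreePattern

open TreePattern in
theorem proposition4 {W : Type*} [Fintype W] (M : SimpleGraph W) (hM : M.IsTree)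
    (hW : 3 ≤ Fintype.card W) :
    ∃ (a₀ : Cls M → ℝ) (μ : ℝ),
      (IsNonnegSolution M (1 / Real.exp 1) a₀ ∧
        ∀ (x : ℝ) (a : Cls M → ℝ), IsNonnegSolution M x a → x = 1 / Real.exp 1 ∧ a = a₀) ∧
      IsLeftPerronVector (jacF M (1 / Real.exp 1) a₀ 1) (fun _ => 1) ∧
      IsMeanConstant M μ ∧
      μ = 1 / Real.exp 1 * ∑ j : PosCls M, evalAt M a₀ 1 (polyU M j) ∧
      ∃ q : Polynomial ℚ, μ = Polynomial.aeval (1 / Real.exp 1 : ℝ) q := by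
  -- The value left open for `μ` is supplied by `isMeanConstant`: a rational multiple of a single
  -- power of `1/e`, which is why the polynomial is a monomial.
  refine ⟨critWeight (outDegrees M) (subHeight M + 1), _,
    ⟨isNonnegSolution_critWeight M, fun x a h => h.eq_critWeight M⟩, isLeftPerronVector_one M,
    isMeanConstant hM hW, (sum_evalAt_polyU_critWeight hM hW).symm,
    Polynomial.C ((leaves M).card / Nat.card (M ≃g M) : ℚ) *
      Polynomial.X ^ (internals M).card, ?_⟩
  simp
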